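/- For $s\in\mathbb H$ let $X_s=\mathbb C/(\mathbb Z\oplus s\mathbb Z)$, and let $\mathcal X=(\mathbb C\times\mathbb H)/\{g_{n,m}\}\to\mathbb H$, $g_{n,m}(z,s)=(z+n+ms,s)$ ($n,m\in\mathbb Z$), be the universal family of marked elliptic curves. A complexified Kähler class on $X_s$ is a class in $H^{1,1}(X_s,\mathbb C)$ whose imaginary part contains a Kähler form. For each $s\in\mathbb H$ the map sending $\alpha\in\mathbb H$ to the class of $\frac{\alpha}{\operatorname{Im}s}\,\frac i2\,dz\wedge d\bar z$ is a bijection of $\mathbb H$ onto the set of complexified Kähler classes on $X_s$; this identifies the bundle $\mathcal K\to\mathbb H$ of complexified Kähler cones with $\mathbb H\times\mathbb H\ni(\alpha,s)$, and $\mathcal X\times_{\mathbb H}\mathcal K$ with the quotient $q:\mathbb C\times\mathbb H\times\mathbb H\to\mathcal X\times_{\mathbb H}\mathcal K$ by the maps $(z,\alpha,s)\mapsto(z+n+ms,\alpha,s)$. The natural hermitian metric $\omega$ on $\mathcal X\times_{\mathbb H}\mathcal K$ is the smooth hermitian metric on the holomorphic tangent bundle characterised as follows. At $(z,\alpha,s)$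 let $g\,dz\otimes d\bar z$ be the Ricci-flat Kähler metric on $X_s$ whose Kähler form $\frac i2\,g\,dz\wedge d\bar z$ lies in $\operatorname{Im}\alpha$; $L^2$ products are taken with respect to this form, with pointwise norms $|\partial_z|^2=g$, $|dz|^2=|d\bar z|^2=g^{-1}$, $|dz\wedge d\bar z|^2=g^{-2}$, $|d\bar z\otimes\partial_z|^2=1$. 1. The relative tangent bundle is the orthogonal sum $T_{\mathcal X/\mathbb H}\oplus T_{\mathcal K/\mathbb H}$; on $T_{\mathcal X/\mathbb H}=T_{X_s,z}$ the metric is $g$, and on $T_{\mathcal K/\mathbb H}=H^{1,1}(X_s,\mathbb C)$ it is the $L^2$ product of $g$-harmonic representatives. 2. A tangent vector $v$ of $\mathbb H$ at $s$ is lifted to $\mathcal X\times_{\mathbb H}\mathcal K$ as follows. In $\mathcal X$ one takes the smooth lift $\eta$ of $v$ along $X_s$ for which $\bar\partial\eta|_{X_s}$ is $g$-harmonic and which is tangent to the zero section $s\mapsto[0,s]$. In $\mathcal K$ one takes the horizontal lift for the Gauss–Manin connection. The lifted vectors are orthogonal to the relative tangent bundle, and on them the metric is the pullback by the Kodaira–Spencer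 map $T_{\mathbb H,s}\to H^1(X_s,T_{X_s})$ of the $L^2$ product of $g$-harmonic representatives. **Proposition.** There is exactly one such metric $\omega$, and in the frame $\partial_z,\partial_\alpha,\partial_s$ its pullback to $\mathbb C\times\mathbb H\times\mathbb H$ is given by the matrix $$q^*\omega=\begin{pmatrix} g_{\mathcal X/S}&0&g_{\mathcal X/S}\,\bar a\\ 0&g_{L^2}&0\\ a\,g_{\mathcal X/S}&0&g_{WP}+a\,g_{\mathcal X/S}\,\bar a\end{pmatrix},$$ where, at $(z,\alpha,s)$, $$g_{\mathcal X/S}=\frac{\alpha-\bar\alpha}{s-\bar s},\qquad g_{L^2}=\frac i2\,\frac1{\alpha-\bar\alpha},\qquad g_{WP}=\frac i2\,\frac{\alpha-\bar\alpha}{(s-\bar s)^2},\qquad a=-\frac{z-\bar z}{s-\bar s}.$$ -/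

import Mathlib

open Complex
open scoped UpperHalfPlane Manifold ContDiff ComplexConjugate Topology

noncomputable section

namespace EllipticFamily

/-! ### The elliptic curves `X_s = ℂ / (ℤ ⊕ sℤ)` and their differential forms -/

/-- The lattice `ℤ ⊕ sℤ`. -/
def lattice (s : ℍ) : AddSubgroup ℂ where
  carrier := {w | ∃ n m : ℤ, w = n + m * (s : ℂ)}
  zero_mem' := ⟨0, 0, by simp⟩
  add_mem' := by
    rintro _ _ ⟨n, m, rfl⟩ ⟨n', m', rfl⟩
    exact ⟨n + n', m + m', by push_cast; ring⟩
  neg_mem' := by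
    rintro _ ⟨n, m, rfl⟩
    exact ⟨-n, -m, by push_cast; ring⟩

/-- The elliptic curve `X_s`. -/
abbrev Curve (s : ℍ) : Type := ℂ ⧸ lattice s

theorem Curve.coe_add (s : ℍ) (z : ℂ) (n m : ℤ) :
    ((z + n + m * (s : ℂ) : ℂ) : Curve s) = (z : Curve s) := by
  rw [QuotientAddGroup.eq]
  exact ⟨-n, -m, by push_cast; ring⟩

/-- `∂f/∂z = (∂f/∂x - i ∂f/∂y)/2`. -/
def dz (f : ℂ → ℂ) (z : ℂ) : ℂ := (fderiv ℝ f z 1 - I * fderiv ℝ f z I) / 2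

/-- `∂f/∂z̄ = (∂f/∂x + i ∂f/∂y)/2`. -/
def dzbar (f : ℂ → ℂ) (z : ℂ) : ℂ := (fderiv ℝ f z 1 + I * fderiv ℝ f z I) / 2

theorem dz_add {f g : ℂ → ℂ} {z : ℂ} (hf : DifferentiableAt ℝ f z)
    (hg : DifferentiableAt ℝ g z) : dz (fun w => f w + g w) z = dz f z + dz g z := by
  simp only [dz, fderiv_fun_add hf hg, add_apply]
  ring

theorem dzbar_add {f g : ℂ → ℂ} {z : ℂ} (hf : DifferentiableAt ℝ f z)
    (hg : DifferentiableAt ℝ g z) :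
    dzbar (fun w => f w + g w) z = dzbar f z + dzbar g z := by
  simp only [dzbar, fderiv_fun_add hf hg, add_apply]
  ring

theorem dz_const_mul {f : ℂ → ℂ} {z : ℂ} (c : ℂ) (hf : DifferentiableAt ℝ f z) :
    dz (fun w => c * f w) z = c * dz f z := by
  simp only [dz, fderiv_const_mul hf, smul_apply, smul_eq_mul]
  ring

theorem dzbar_const_mul {f : ℂ → ℂ} {z : ℂ} (c : ℂ) (hf : DifferentiableAt ℝ f z) :
    dzbar (fun w => c * f w) z = c * dzbar f z := by
  simp only [dzbar, fderiv_const_mul hf, smul_apply, smul_eq_mul]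
  ring

/-- The smooth complex functions on `X_s`.

The translation invariant frames `∂_z`, `dz`, `dz̄` trivialise the bundles of tensors of `X_s`; a
smooth function `f` is used below as the coefficient of the 2-form `f dz ∧ dz̄` (every 2-form on
`X_s` is of type `(1,1)` and closed), of the vector field `f ∂_z` of type `(1,0)`, or of the
`(0,1)`-form with values in the holomorphic tangent bundle `f dz̄ ⊗ ∂_z`. -/
def smoothFunctions (s : ℍ) : Submodule ℂ (Curve s → ℂ) where
  carrier := {f | ContDiff ℝ ∞ fun z : ℂ => f z}
  zero_mem' := by
    change ContDiff ℝ ∞ fun _ : ℂ => (0 : ℂ)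
    exact contDiff_const
  add_mem' {f g} hf hg := by
    change ContDiff ℝ ∞ fun z : ℂ => f z + g z
    exact ContDiff.add hf hg
  smul_mem' c f hf := by
    change ContDiff ℝ ∞ fun z : ℂ => c * f z
    exact ContDiff.mul contDiff_const hf

theorem differentiable_coe {s : ℍ} (f : smoothFunctions s) :
    Differentiable ℝ fun z : ℂ => f.1 z :=
  ContDiff.differentiable (n := ∞) f.2 (by simp)

/-- The exact 2-forms: `d (u dz + v dz̄) = (∂_z v - ∂_z̄ u) dz ∧ dz̄`. -/
def exactForms (s : ℍ) : Submodule ℂ (smoothFunctions s) where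
  carrier := {f | ∃ u v : smoothFunctions s, ∀ z : ℂ,
    f.1 z = dz (fun w => v.1 w) z - dzbar (fun w => u.1 w) z}
  zero_mem' := ⟨0, 0, fun z => by simp [dz, dzbar]⟩
  add_mem' := by
    rintro f g ⟨u, v, hf⟩ ⟨u', v', hg⟩
    refine ⟨u + u', v + v', fun z => ?_⟩
    have h1 := dz_add (differentiable_coe v z) ((differentiable_coe v') z)
    have h2 := dzbar_add ((differentiable_coe u) z) ((differentiable_coe u') z)
    have h3 : (f + g).1 z = f.1 z + g.1 z := rfl
    rw [h3, hf, hg]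
    change _ = dz (fun w => v.1 w + v'.1 w) z - dzbar (fun w => u.1 w + u'.1 w) z
    rw [h1, h2]
    ring
  smul_mem' := by
    rintro c f ⟨u, v, hf⟩
    refine ⟨c • u, c • v, fun z => ?_⟩
    have h1 := dz_const_mul c (differentiable_coe v z)
    have h2 := dzbar_const_mul c ((differentiable_coe u) z)
    have h3 : (c • f).1 z = c * f.1 z := rfl
    rw [h3, hf]
    change _ = dz (fun w => c * v.1 w) z - dzbar (fun w => c * u.1 w) z
    rw [h1, h2]
    ring

/-- `H²(X_s, ℂ) = H^{1,1}(X_s, ℂ)`: (closed) `(1,1)`-forms modulo exact forms. -/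
abbrev H11 (s : ℍ) : Type := smoothFunctions s ⧸ exactForms s

/-- The class of the 2-form `f dz ∧ dz̄`. -/
def formClass {s : ℍ} (f : smoothFunctions s) : H11 s := (exactForms s).mkQ f

/-- The `∂̄`-exact `(0,1)`-forms with values in the holomorphic tangent bundle:
`∂̄ (v ∂_z) = (∂_z̄ v) dz̄ ⊗ ∂_z`. -/
def exactTangentForms (s : ℍ) : Submodule ℂ (smoothFunctions s) where
  carrier := {f | ∃ v : smoothFunctions s, ∀ z : ℂ, f.1 z = dzbar (fun w => v.1 w) z}
  zero_mem' := ⟨0, fun z => by simp [dzbar]⟩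
  add_mem' := by
    rintro f g ⟨v, hf⟩ ⟨v', hg⟩
    refine ⟨v + v', fun z => ?_⟩
    have h1 := dzbar_add (differentiable_coe v z) ((differentiable_coe v') z)
    have h3 : (f + g).1 z = f.1 z + g.1 z := rfl
    rw [h3, hf, hg]
    exact h1.symm
  smul_mem' := by
    rintro c f ⟨v, hf⟩
    refine ⟨c • v, fun z => ?_⟩
    have h1 := dzbar_const_mul c (differentiable_coe v z)
    have h3 : (c • f).1 z = c * f.1 z := rfl
    rw [h3, hf]
    exact h1.symm

/-- The Dolbeault cohomology group `H¹(X_s, T_{X_s})` (every `T`-valued `(0,1)`-form is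
`∂̄`-closed on a curve). -/
abbrev H1T (s : ℍ) : Type := smoothFunctions s ⧸ exactTangentForms s

/-- The class of `f dz̄ ⊗ ∂_z`. -/
def tangentFormClass {s : ℍ} (f : smoothFunctions s) : H1T s := (exactTangentForms s).mkQ f

/-- `∫_{X_s} f dz ∧ dz̄`, computed in the parametrisation `[0,1]² → X_s`, `(x, y) ↦ x + y s`, in
which `dz ∧ dz̄ = (s̄ - s) dx ∧ dy`. -/
def integral (s : ℍ) (f : Curve s → ℂ) : ℂ :=
  ∫ y in (0 : ℝ)..1, ∫ x in (0 : ℝ)..1, f (x + y * (s : ℂ) : ℂ) * (conj (s : ℂ) - s)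

/-! ### Ricci-flat Kähler metrics, harmonic forms -/

/-- A Kähler metric `g dz ⊗ dz̄` on `X_s`, with Kähler form `(i/2) g dz ∧ dz̄`. (On a curve the
Kähler form of any hermitian metric is closed.) -/
structure KahlerMetric (s : ℍ) where
  coeff : Curve s → ℝ
  smooth : ContDiff ℝ ∞ fun z : ℂ => coeff z
  pos : ∀ x, 0 < coeff x

/-- The Ricci form `-i ∂∂̄ log g` vanishes. -/
def KahlerMetric.RicciFlat {s : ℍ} (g : KahlerMetric s) : Prop :=
  ∀ z : ℂ, dz (dzbar fun w : ℂ => (Real.log (g.coeff w) : ℂ)) z = 0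

/-- The imaginary part of the class `κ` contains the Kähler form of `g`: some form
`η = f dz ∧ dz̄` in `κ` has `Im η = (η - η̄) / 2i = (i/2) g dz ∧ dz̄`, where
`η̄ = - f̄ dz ∧ dz̄`. -/
def ImContains {s : ℍ} (κ : H11 s) (g : KahlerMetric s) : Prop :=
  ∃ f : smoothFunctions s, formClass f = κ ∧
    ∀ x, (f.1 x - -conj (f.1 x)) / (2 * I) = I / 2 * (g.coeff x : ℂ)

/-- The complexified Kähler cone `K^ℂ(X_s) ⊆ H^{1,1}(X_s, ℂ)`. -/
def complexifiedKahlerCone (s : ℍ) : Set (H11 s) := {κ | ∃ g : KahlerMetric s, ImContains κ g}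

/-- `L²` inner product of `f dz ∧ dz̄` and `h dz ∧ dz̄`: pointwise `|dz ∧ dz̄|² = |dz|²|dz̄|² = g⁻²`,
and the volume form is the Kähler form `(i/2) g dz ∧ dz̄`. -/
def innerForms {s : ℍ} (g : KahlerMetric s) (f h : smoothFunctions s) : ℂ :=
  integral s fun x =>
    (f.1 x * conj (h.1 x) * ((g.coeff x : ℂ)⁻¹ * (g.coeff x : ℂ)⁻¹)) * (I / 2 * (g.coeff x : ℂ))

/-- `L²` inner product of `f dz̄ ⊗ ∂_z` and `h dz̄ ⊗ ∂_z`: pointwise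
`|dz̄ ⊗ ∂_z|² = |dz̄|²|∂_z|² = g⁻¹ g`, and the volume form is `(i/2) g dz ∧ dz̄`. -/
def innerTangentForms {s : ℍ} (g : KahlerMetric s) (f h : smoothFunctions s) : ℂ :=
  integral s fun x =>
    (f.1 x * conj (h.1 x) * ((g.coeff x : ℂ)⁻¹ * (g.coeff x : ℂ))) * (I / 2 * (g.coeff x : ℂ))

/-- `f dz ∧ dz̄` is `g`-harmonic: it is closed, and `d^*`-closed, i.e. orthogonal to the exact
forms. -/
def IsHarmonicForm {s : ℍ} (g : KahlerMetric s) (f : smoothFunctions s) : Prop :=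
  ∀ e ∈ exactForms s, innerForms g f e = 0

/-- `f dz̄ ⊗ ∂_z` is `g`-harmonic: it is `∂̄`-closed, and `∂̄^*`-closed, i.e. orthogonal to the
`∂̄`-exact forms. -/
def IsHarmonicTangentForm {s : ℍ} (g : KahlerMetric s) (f : smoothFunctions s) : Prop :=
  ∀ e ∈ exactTangentForms s, innerTangentForms g f e = 0

/-! ### The bundle of complexified Kähler cones and the Gauss-Manin connection -/

section Stokes

variable {s : ℍ} (v : smoothFunctions s)

theorem continuous_fderiv_coe (e : ℂ) :
    Continuous fun z : ℂ => fderiv ℝ (fun w : ℂ => v.1 w) z e :=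
  (ContDiff.continuous_fderiv (n := ∞) v.2 (by simp)).clm_apply continuous_const

theorem integral_fderiv_one (y : ℝ) :
    ∫ x in (0 : ℝ)..1, fderiv ℝ (fun w : ℂ => v.1 w) (x + y * (s : ℂ)) 1 = 0 := by
  have hd : ∀ x : ℝ, HasDerivAt (fun x : ℝ => v.1 ((x + y * (s : ℂ) : ℂ) : Curve s))
      (fderiv ℝ (fun w : ℂ => v.1 w) (x + y * (s : ℂ)) 1) x := fun x => by
    have h1 : HasDerivAt (fun x : ℝ => (x : ℂ) + y * (s : ℂ)) 1 x :=
      (ofRealCLM.hasDerivAt (x := x)).add_const _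
    exact ((differentiable_coe v) _).hasFDerivAt.comp_hasDerivAt x h1
  rw [intervalIntegral.integral_eq_sub_of_hasDerivAt (fun x _ => hd x)]
  · have := Curve.coe_add s (y * (s : ℂ)) 1 0
    simp only [ofReal_one, ofReal_zero, zero_add]
    rw [show (1 : ℂ) + y * (s : ℂ) = y * (s : ℂ) + (1 : ℤ) + (0 : ℤ) * (s : ℂ) by
      push_cast; ring, this, sub_self]
  · exact Continuous.intervalIntegrable
      ((continuous_fderiv_coe v 1).comp (by fun_prop)) _ _

theorem integral_fderiv_tau (x : ℝ) :
    ∫ y in (0 : ℝ)..1, fderiv ℝ (fun w : ℂ => v.1 w) (x + y * (s : ℂ)) s = 0 := by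
  have hd : ∀ y : ℝ, HasDerivAt (fun y : ℝ => v.1 ((x + y * (s : ℂ) : ℂ) : Curve s))
      (fderiv ℝ (fun w : ℂ => v.1 w) (x + y * (s : ℂ)) s) y := fun y => by
    have h1 : HasDerivAt (fun y : ℝ => (x : ℂ) + y * (s : ℂ)) s y := by
      simpa using ((ofRealCLM.hasDerivAt (x := y)).mul_const (s : ℂ)).const_add (x : ℂ)
    exact ((differentiable_coe v) _).hasFDerivAt.comp_hasDerivAt y h1
  rw [intervalIntegral.integral_eq_sub_of_hasDerivAt (fun x _ => hd x)]
  · have := Curve.coe_add s (x : ℂ) 0 1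
    simp only [ofReal_one, ofReal_zero, zero_mul, add_zero]
    rw [show (x : ℂ) + 1 * (s : ℂ) = x + (0 : ℤ) + (1 : ℤ) * (s : ℂ) by
      push_cast; ring, this, sub_self]
  · exact Continuous.intervalIntegrable
      ((continuous_fderiv_coe v s).comp (by fun_prop)) _ _

theorem integral_integral_fderiv (e : ℂ) :
    ∫ y in (0 : ℝ)..1, ∫ x in (0 : ℝ)..1,
      fderiv ℝ (fun w : ℂ => v.1 w) (x + y * (s : ℂ)) e = 0 := by
  have hs : s.im ≠ 0 := s.im_pos.ne'
  have he : e = ((e.re - e.im / s.im * s.re : ℝ)) • (1 : ℂ) + (e.im / s.im : ℝ) • (s : ℂ) := by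
    apply Complex.ext
    · simp
    · simp [hs]
  have hc : ∀ d : ℂ, Continuous fun p : ℝ × ℝ =>
      fderiv ℝ (fun w : ℂ => v.1 w) (p.2 + p.1 * (s : ℂ)) d := fun d =>
    (continuous_fderiv_coe v d).comp (by fun_prop)
  have hsw : ∫ y in (0 : ℝ)..1, ∫ x in (0 : ℝ)..1,
      fderiv ℝ (fun w : ℂ => v.1 w) (x + y * (s : ℂ)) s = 0 := by
    have hsw' : ∫ y in (0 : ℝ)..1, ∫ x in (0 : ℝ)..1,
        fderiv ℝ (fun w : ℂ => v.1 w) (x + y * (s : ℂ)) s = ∫ x in (0 : ℝ)..1,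
        ∫ y in (0 : ℝ)..1, fderiv ℝ (fun w : ℂ => v.1 w) (x + y * (s : ℂ)) s := by
      simp only [intervalIntegral.integral_of_le zero_le_one]
      refine MeasureTheory.integral_integral_swap ?_
      rw [MeasureTheory.Measure.prod_restrict]
      exact ((hc s).continuousOn.integrableOn_compact (isCompact_Icc.prod isCompact_Icc)).mono_set
        (Set.prod_mono Set.Ioc_subset_Icc_self Set.Ioc_subset_Icc_self)
    rw [hsw']
    simp [integral_fderiv_tau]
  have hi : ∀ (d : ℂ) (y : ℝ), IntervalIntegrable (fun x : ℝ =>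
      fderiv ℝ (fun w : ℂ => v.1 w) (x + y * (s : ℂ)) d) MeasureTheory.volume 0 1 := fun d y =>
    Continuous.intervalIntegrable ((continuous_fderiv_coe v d).comp (by fun_prop)) _ _
  have key : ∀ y : ℝ, ∫ x in (0 : ℝ)..1,
      fderiv ℝ (fun w : ℂ => v.1 w) (x + y * (s : ℂ)) e = (e.im / s.im : ℝ) •
        ∫ x in (0 : ℝ)..1, fderiv ℝ (fun w : ℂ => v.1 w) (x + y * (s : ℂ)) s := fun y => by
    have h1 : ∀ x : ℝ, fderiv ℝ (fun w : ℂ => v.1 w) (x + y * (s : ℂ)) e =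
        (e.re - e.im / s.im * s.re : ℝ) • fderiv ℝ (fun w : ℂ => v.1 w) (x + y * (s : ℂ)) 1 +
        (e.im / s.im : ℝ) • fderiv ℝ (fun w : ℂ => v.1 w) (x + y * (s : ℂ)) s := fun x => by
      rw [← map_smul, ← map_smul, ← map_add, ← he]
    simp only [h1]
    have i1 := (hi 1 y).smul (e.re - e.im / s.im * s.re : ℝ)
    have i2 := (hi s y).smul (e.im / s.im : ℝ)
    simp only [Pi.smul_def] at i1 i2
    rw [intervalIntegral.integral_add i1 i2,
      intervalIntegral.integral_smul, intervalIntegral.integral_smul, integral_fderiv_one]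
    simp
  simp only [key]
  rw [intervalIntegral.integral_smul, hsw, smul_zero]

end Stokes

theorem continuous_param {s : ℍ} (f : smoothFunctions s) :
    Continuous fun p : ℝ × ℝ =>
      f.1 ((p.2 + p.1 * (s : ℂ) : ℂ) : Curve s) * (conj (s : ℂ) - s) :=
  ((differentiable_coe f).continuous.comp (g := fun z : ℂ => f.1 z)
    (f := fun p : ℝ × ℝ => (p.2 + p.1 * (s : ℂ) : ℂ)) (by fun_prop)).mul continuous_const

/-- Integration of 2-forms. -/
def integralLin (s : ℍ) : smoothFunctions s →ₗ[ℂ] ℂ where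
  toFun f := integral s f.1
  map_add' f g := by
    have hf := continuous_param f
    have hg := continuous_param g
    simp only [integral, Submodule.coe_add, Pi.add_apply, add_mul]
    rw [← intervalIntegral.integral_add]
    · congr 1
      ext y
      exact intervalIntegral.integral_add
        (Continuous.intervalIntegrable (hf.comp (Continuous.prodMk_right y)) _ _)
        (Continuous.intervalIntegrable (hg.comp (Continuous.prodMk_right y)) _ _)
    · exact (intervalIntegral.continuous_parametric_intervalIntegral_of_continuous'
        (f := fun y x : ℝ => f.1 ((x + y * (s : ℂ) : ℂ) : Curve s) * (conj (s : ℂ) - s))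
        hf 0 1).intervalIntegrable _ _
    · exact (intervalIntegral.continuous_parametric_intervalIntegral_of_continuous'
        (f := fun y x : ℝ => g.1 ((x + y * (s : ℂ) : ℂ) : Curve s) * (conj (s : ℂ) - s))
        hg 0 1).intervalIntegrable _ _
  map_smul' c f := by
    simp [integral, mul_assoc, intervalIntegral.integral_const_mul]

theorem exactForms_le_ker (s : ℍ) : exactForms s ≤ LinearMap.ker (integralLin s) := by
  rintro f ⟨u, v, h⟩
  have hc : ∀ (w : smoothFunctions s) (e : ℂ), Continuous fun p : ℝ × ℝ =>
      fderiv ℝ (fun z : ℂ => w.1 z) (p.2 + p.1 * (s : ℂ)) e := fun w e =>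
    (continuous_fderiv_coe w e).comp (by fun_prop)
  have hi : ∀ (w : smoothFunctions s) (e : ℂ) (y : ℝ), IntervalIntegrable (fun x : ℝ =>
      fderiv ℝ (fun z : ℂ => w.1 z) (x + y * (s : ℂ)) e) MeasureTheory.volume 0 1 :=
    fun w e y => Continuous.intervalIntegrable ((continuous_fderiv_coe w e).comp (by fun_prop)) _ _
  have ho : ∀ (w : smoothFunctions s) (e : ℂ), IntervalIntegrable (fun y : ℝ =>
      ∫ x in (0 : ℝ)..1, fderiv ℝ (fun z : ℂ => w.1 z) (x + y * (s : ℂ)) e)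
      MeasureTheory.volume 0 1 := fun w e =>
    (intervalIntegral.continuous_parametric_intervalIntegral_of_continuous'
      (f := fun y x : ℝ => fderiv ℝ (fun z : ℂ => w.1 z) (x + y * (s : ℂ)) e)
      (hc w e) 0 1).intervalIntegrable _ _
  have key : ∀ y x : ℝ, f.1 ((x + y * (s : ℂ) : ℂ) : Curve s) * (conj (s : ℂ) - s) =
      ((conj (s : ℂ) - s) / 2) * fderiv ℝ (fun z : ℂ => v.1 z) (x + y * (s : ℂ)) 1 +
      (-I * (conj (s : ℂ) - s) / 2) * fderiv ℝ (fun z : ℂ => v.1 z) (x + y * (s : ℂ)) I +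
      (-(conj (s : ℂ) - s) / 2) * fderiv ℝ (fun z : ℂ => u.1 z) (x + y * (s : ℂ)) 1 +
      (-I * (conj (s : ℂ) - s) / 2) * fderiv ℝ (fun z : ℂ => u.1 z) (x + y * (s : ℂ)) I :=
    fun y x => by
      rw [h]
      simp only [dz, dzbar]
      ring
  change integral s f.1 = 0
  simp only [integral, key]
  have e1 : ∀ y : ℝ, (∫ x in (0 : ℝ)..1,
      (((conj (s : ℂ) - s) / 2) * fderiv ℝ (fun z : ℂ => v.1 z) (x + y * (s : ℂ)) 1 +
      (-I * (conj (s : ℂ) - s) / 2) * fderiv ℝ (fun z : ℂ => v.1 z) (x + y * (s : ℂ)) I +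
      (-(conj (s : ℂ) - s) / 2) * fderiv ℝ (fun z : ℂ => u.1 z) (x + y * (s : ℂ)) 1 +
      (-I * (conj (s : ℂ) - s) / 2) * fderiv ℝ (fun z : ℂ => u.1 z) (x + y * (s : ℂ)) I)) =
      (((conj (s : ℂ) - s) / 2) * ∫ x in (0 : ℝ)..1, fderiv ℝ (fun z : ℂ => v.1 z) (x + y * (s : ℂ)) 1) +
      ((-I * (conj (s : ℂ) - s) / 2) * ∫ x in (0 : ℝ)..1, fderiv ℝ (fun z : ℂ => v.1 z) (x + y * (s : ℂ)) I) +
      ((-(conj (s : ℂ) - s) / 2) * ∫ x in (0 : ℝ)..1, fderiv ℝ (fun z : ℂ => u.1 z) (x + y * (s : ℂ)) 1) +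
      ((-I * (conj (s : ℂ) - s) / 2) * ∫ x in (0 : ℝ)..1, fderiv ℝ (fun z : ℂ => u.1 z) (x + y * (s : ℂ)) I) := by
    intro y
    have i1 := (hi v 1 y).const_mul ((conj (s : ℂ) - s) / 2)
    have i2 := (hi v I y).const_mul (-I * (conj (s : ℂ) - s) / 2)
    have i3 := (hi u 1 y).const_mul (-(conj (s : ℂ) - s) / 2)
    have i4 := (hi u I y).const_mul (-I * (conj (s : ℂ) - s) / 2)
    rw [intervalIntegral.integral_add ((i1.add i2).add i3) i4,
      intervalIntegral.integral_add (i1.add i2) i3, intervalIntegral.integral_add i1 i2]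
    simp only [intervalIntegral.integral_const_mul]
  simp only [e1]
  have i1 := (ho v 1).const_mul ((conj (s : ℂ) - s) / 2)
  have i2 := (ho v I).const_mul (-I * (conj (s : ℂ) - s) / 2)
  have i3 := (ho u 1).const_mul (-(conj (s : ℂ) - s) / 2)
  have i4 := (ho u I).const_mul (-I * (conj (s : ℂ) - s) / 2)
  rw [intervalIntegral.integral_add ((i1.add i2).add i3) i4,
    intervalIntegral.integral_add (i1.add i2) i3, intervalIntegral.integral_add i1 i2]
  simp only [intervalIntegral.integral_const_mul, integral_integral_fderiv]
  simp

/-- The period `∫_{X_s} κ` of a class `κ ∈ H²(X_s, ℂ)` on the fundamental class of `X_s`. -/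
def period (s : ℍ) : H11 s →ₗ[ℂ] ℂ := (exactForms s).liftQ (integralLin s) (exactForms_le_ker s)

/-- The class `(a / Im s) (i/2) dz ∧ dz̄` on `X_s`, depending linearly on `a ∈ ℂ`. -/
def constClass (s : ℍ) : ℂ →ₗ[ℂ] H11 s where
  toFun a := formClass ⟨fun _ => a / (s.im : ℂ) * (I / 2),
    (contDiff_const : ContDiff ℝ ∞ fun _ : ℂ => a / (s.im : ℂ) * (I / 2))⟩
  map_add' a b := by
    simp only [formClass]
    rw [← map_add]
    congr 1
    ext x
    simp [add_div, add_mul]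
  map_smul' c a := by
    simp only [formClass]
    rw [← map_smul]
    congr 1
    ext x
    simp [mul_div_assoc, mul_assoc]

/-- The identification of `ℍ × ℍ` with the bundle `𝒦 → ℍ` of complexified Kähler cones:
`(α, s)` is the class `(α / Im s) (i/2) dz ∧ dz̄` on `X_s`. -/
def kahlerClass (α s : ℍ) : H11 s := constClass s α

/-- The tangent vector `(β, v)` at `(α, s)` of `𝒦 ≅ ℍ × ℍ` is horizontal for the Gauss-Manin
connection. Here `E^{1,1} = E²` is the bundle of the `H²(X_s, ℂ)`, its flat sections are those
with locally constant periods, and `H_2(X_s, ℤ)` is generated by the fundamental class; so the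
horizontal vectors are those in whose direction the period on `𝒦` has zero derivative. -/
def IsGaussManinHorizontal (α s : ℍ) (β v : ℂ) : Prop :=
  (mfderiv (𝓘(ℂ).prod 𝓘(ℂ)) 𝓘(ℂ) (fun κ : ℍ × ℍ => period κ.2 (kahlerClass κ.1 κ.2)) (α, s) :
    ℂ × ℂ → ℂ) (β, v) = 0

/-! ### Lifts of tangent vectors of the base, and the Kodaira-Spencer map -/

/-- `b ∂_z + v ∂_s` is a smooth section over `X_s` of the holomorphic tangent bundle of the
universal family `𝒳 = (ℂ × ℍ) / {g_{n,m}}`, `g_{n,m} (z, s) = (z + n + m s, s)`, which lifts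
the tangent vector `v ∂_s` of `ℍ` at `s`: it is invariant under the differentials of the
`g_{n,m}`. -/
def IsSmoothLift (s : ℍ) (v : ℂ) (b : ℂ → ℂ) : Prop :=
  ContDiff ℝ ∞ b ∧ ∀ (z : ℂ) (n m : ℤ),
    fderiv ℂ (fun w : ℂ × ℂ => (w.1 + n + m * w.2, w.2)) (z, (s : ℂ)) (b z, v) =
      (b (z + n + m * (s : ℂ)), v)

/-- The `T_{X_s}`-valued `(0,1)`-form `∂̄ (b ∂_z + v ∂_s) = (∂_z̄ b) dz̄ ⊗ ∂_z` on `X_s` is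
`f dz̄ ⊗ ∂_z`. -/
def IsDbarOfLift (s : ℍ) (b : ℂ → ℂ) (f : smoothFunctions s) : Prop :=
  ∀ z : ℂ, f.1 z = dzbar b z

/-- `c` is the image of `v ∂_s` under the Kodaira-Spencer map `T_{ℍ,s} → H¹(X_s, T_{X_s})`. -/
def IsKodairaSpencer (s : ℍ) (v : ℂ) (c : H1T s) : Prop :=
  ∃ b f, IsSmoothLift s v b ∧ IsDbarOfLift s b f ∧ tangentFormClass f = c

/-- `b ∂_z + v ∂_s` is the canonical lift of `v ∂_s` to `𝒳` along `X_s` with respect to `g`: its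
`∂̄` is `g`-harmonic, and it is tangent to the zero section `s ↦ [0, s]` of `𝒳 → ℍ`. (The first
condition determines the lift up to a holomorphic vector field on `X_s` only.) -/
def IsCanonicalLift {s : ℍ} (g : KahlerMetric s) (v : ℂ) (b : ℂ → ℂ) : Prop :=
  IsSmoothLift s v b ∧ (∃ f, IsDbarOfLift s b f ∧ IsHarmonicTangentForm g f) ∧ b 0 = 0

/-! ### The fiber product `𝒳 ×_ℍ 𝒦` as a complex manifold -/

/-- The space `ℂ × ℍ × ℍ` of triples `(z, α, s)`. -/
abbrev Cover : Type := ℂ × ℍ × ℍ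

/-- The model of `ℂ × ℍ × ℍ` as a complex manifold. -/
abbrev model : ModelWithCorners ℂ (ℂ × ℂ × ℂ) (ModelProd ℂ (ModelProd ℂ ℂ)) :=
  𝓘(ℂ).prod (𝓘(ℂ).prod 𝓘(ℂ))

/-- The action of the group `{g_{n,m}} ≅ ℤ × ℤ`,
`g_{n,m} (z, α, s) = (z + n + m s, α, s)`. -/
instance : AddAction (ℤ × ℤ) Cover where
  vadd γ p := (p.1 + γ.1 + γ.2 * (p.2.2 : ℂ), p.2)
  zero_vadd p := by
    change ((p.1 + ((0 : ℤ) : ℂ) + ((0 : ℤ) : ℂ) * (p.2.2 : ℂ), p.2) : Cover) = p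
    simp
  add_vadd γ δ p := by
    change ((p.1 + ((γ.1 + δ.1 : ℤ) : ℂ) + ((γ.2 + δ.2 : ℤ) : ℂ) * (p.2.2 : ℂ), p.2) : Cover) =
      (p.1 + δ.1 + δ.2 * (p.2.2 : ℂ) + γ.1 + γ.2 * (p.2.2 : ℂ), p.2)
    push_cast
    congr 1
    ring

theorem vadd_def (γ : ℤ × ℤ) (p : Cover) :
    γ +ᵥ p = (p.1 + γ.1 + γ.2 * (p.2.2 : ℂ), p.2) := rfl

instance : ContinuousConstVAdd (ℤ × ℤ) Cover where
  continuous_const_vadd γ := by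
    simp only [vadd_def]
    fun_prop

theorem eq_zero_of_add_mul_eq_zero {n m : ℤ} {s : ℍ} (h : (n : ℂ) + m * (s : ℂ) = 0) :
    n = 0 ∧ m = 0 := by
  have hm : m = 0 := by
    have := congrArg Complex.im h
    simpa [s.im_pos.ne'] using this
  subst hm
  exact ⟨by simpa using h, rfl⟩

instance : IsCancelVAdd (ℤ × ℤ) Cover where
  left_cancel' γ p p' h := by
    have := congrArg (fun x => -γ +ᵥ x) h
    simpa using this
  right_cancel' γ δ p h := by
    have h1 := congrArg Prod.fst h
    simp only [vadd_def] at h1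
    have := eq_zero_of_add_mul_eq_zero (n := γ.1 - δ.1) (m := γ.2 - δ.2) (s := p.2.2) (by
      push_cast
      linear_combination h1)
    ext <;> omega

instance : ProperlyDiscontinuousVAdd (ℤ × ℤ) Cover where
  finite_disjoint_inter_image := by
    intro K L hK hL
    rcases K.eq_empty_or_nonempty with rfl | hne
    · simp
    obtain ⟨A, hA⟩ := (hK.image (f := fun p : Cover => p.1) (by fun_prop)).isBounded.exists_norm_le
    obtain ⟨B, hB⟩ := (hL.image (f := fun p : Cover => p.1) (by fun_prop)).isBounded.exists_norm_le
    obtain ⟨C, hC⟩ := (hK.image (f := fun p : Cover => (p.2.2 : ℂ))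
      (by fun_prop)).isBounded.exists_norm_le
    obtain ⟨p₀, -, hp₀⟩ := hK.exists_isMinOn hne (f := fun p : Cover => p.2.2.im)
      (UpperHalfPlane.continuous_im.comp (by fun_prop)).continuousOn
    set c := p₀.2.2.im with hc
    have hcpos : 0 < c := p₀.2.2.im_pos
    set D : ℝ := (A + B) / c with hD
    set F : ℝ := A + B + D * C with hF
    refine Set.Finite.subset
      ((Set.finite_Icc (-⌈F⌉) ⌈F⌉).prod (Set.finite_Icc (-⌈D⌉) ⌈D⌉)) ?_
    rintro ⟨n, m⟩ ⟨_, ⟨p, hp, rfl⟩, hpL⟩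
    have h1 : ‖p.1‖ ≤ A := hA _ ⟨p, hp, rfl⟩
    have h2 : ‖p.1 + n + m * (p.2.2 : ℂ)‖ ≤ B := hB _ ⟨_, hpL, rfl⟩
    have h3 : ‖(p.2.2 : ℂ)‖ ≤ C := hC _ ⟨p, hp, rfl⟩
    have h4 : c ≤ p.2.2.im := hp₀ hp
    have h5 : ‖(n : ℂ) + m * (p.2.2 : ℂ)‖ ≤ A + B := by
      have := norm_sub_le (p.1 + n + m * (p.2.2 : ℂ)) p.1
      rw [show p.1 + n + m * (p.2.2 : ℂ) - p.1 = n + m * (p.2.2 : ℂ) by ring] at this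
      linarith
    have h6 : |(m : ℝ)| ≤ D := by
      have := (Complex.abs_im_le_norm ((n : ℂ) + m * (p.2.2 : ℂ))).trans h5
      simp only [add_im, intCast_im, zero_add, mul_im, intCast_re, UpperHalfPlane.coe_im,
        zero_mul, add_zero, abs_mul, abs_of_pos p.2.2.im_pos] at this
      rw [hD, le_div_iff₀ hcpos]
      exact (mul_le_mul_of_nonneg_left h4 (abs_nonneg _)).trans this
    have h7 : |(n : ℝ)| ≤ F := by
      have h8 := norm_sub_le ((n : ℂ) + m * (p.2.2 : ℂ)) (m * (p.2.2 : ℂ))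
      rw [add_sub_cancel_right, norm_mul, Complex.norm_intCast, Complex.norm_intCast] at h8
      have := mul_le_mul h6 h3 (norm_nonneg _) ((abs_nonneg _).trans h6)
      linarith
    have h8 : ∀ (k : ℤ) (R : ℝ), |(k : ℝ)| ≤ R → k ∈ Set.Icc (-⌈R⌉) ⌈R⌉ := fun k R hk => by
      have h9 : |(k : ℝ)| ≤ (⌈R⌉ : ℝ) := hk.trans (Int.le_ceil R)
      rw [abs_le] at h9
      exact ⟨by exact_mod_cast h9.1, by exact_mod_cast h9.2⟩
    exact ⟨h8 n F h7, h8 m D h6⟩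

/-- The fiber product `𝒳 ×_ℍ 𝒦`, the quotient of `ℂ × ℍ × ℍ` by the group `{g_{n,m}}`. Its charts
are the local inverses of the quotient map. -/
abbrev FibreProduct : Type := AddAction.orbitRel.Quotient (ℤ × ℤ) Cover

theorem contMDiff_vadd (γ : ℤ × ℤ) : ContMDiff model model ω (fun p : Cover => γ +ᵥ p) := by
  have h : ContMDiff model 𝓘(ℂ) ω (fun p : Cover => (p.2.2 : ℂ)) :=
    UpperHalfPlane.contMDiff_coe.comp (contMDiff_snd.comp contMDiff_snd)
  have h1 : ContMDiff model 𝓘(ℂ) ω (fun p : Cover => p.1 + (γ.1 : ℂ) + γ.2 * (p.2.2 : ℂ)) :=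
    (contMDiff_fst.add contMDiff_const).add (contMDiff_const.mul h)
  exact h1.prodMk contMDiff_snd

/-- The fiber product is a complex manifold. -/
instance : IsManifold model ω FibreProduct := by
  refine isManifold_of_contDiffOn model ω FibreProduct ?_
  have hcov := isAddQuotientCoveringMap_quotientMk_of_properlyDiscontinuousVAdd
      (E := Cover) (G := ℤ × ℤ)
  have hq := hcov.isCoveringMap.isLocalHomeomorph
  have key : ∀ a a' : Cover, ∀ e e' : OpenPartialHomeomorph FibreProduct
      (ModelProd ℂ (ModelProd ℂ ℂ)), e = (hq.localInverseAt a).trans (chartAt _ a) →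
      e' = (hq.localInverseAt a').trans (chartAt _ a') →
      ContDiffOn ℂ ω (model ∘ (e.symm.trans e') ∘ model.symm)
        (model.symm ⁻¹' (e.symm.trans e').source ∩ Set.range model) := by
    rintro a a' e e' rfl rfl t ⟨ht, -⟩
    set A := hq.localInverseAt a with hA
    set B := hq.localInverseAt a' with hB
    have hAs : ∀ p, A.symm p = Quotient.mk _ p := fun p => congrFun (hq.localInverseAt_symm a) p
    have hBs : ∀ p, B.symm p = Quotient.mk _ p := fun p => congrFun (hq.localInverseAt_symm a') p
    set c := chartAt (ModelProd ℂ (ModelProd ℂ ℂ)) a with hc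
    set c' := chartAt (ModelProd ℂ (ModelProd ℂ ℂ)) a' with hc'
    set p : Cover := c.symm (model.symm t) with hp
    simp only [Set.mem_preimage, OpenPartialHomeomorph.trans_source,
      OpenPartialHomeomorph.symm_source, Set.mem_inter_iff,
      OpenPartialHomeomorph.trans_symm_eq_symm_trans_symm, OpenPartialHomeomorph.coe_trans,
      Function.comp_apply] at ht
    obtain ⟨⟨ht1, ht2⟩, ht3, ht4⟩ := ht
    rw [← hp] at ht2 ht3 ht4
    rw [hAs] at ht3 ht4
    have hBp : Quotient.mk (AddAction.orbitRel (ℤ × ℤ) Cover) (B (Quotient.mk _ p)) =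
        Quotient.mk _ p := hq.apply_localInverseAt_of_mem ht3
    obtain ⟨γ, hγ⟩ := hcov.apply_eq_iff_mem_orbit.mp hBp
    change γ +ᵥ p = _ at hγ
    have hps : p ∈ c.source := c.map_target ht1
    have hm := (contMDiff_vadd γ) p
    rw [contMDiffAt_iff_of_mem_source (x := a) (y := a') hps
      (by rw [hγ]; exact ht4)] at hm
    have hpt : extChartAt model a p = t := by
      change model (c p) = t
      rw [hp, c.right_inv ht1]
      exact model.right_inv (by simp)
    rw [hpt] at hm
    refine (hm.2.mono Set.inter_subset_right).congr_of_eventuallyEq ?_ ?_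
    · have h1 : ∀ᶠ t' in 𝓝 t, γ +ᵥ c.symm (model.symm t') ∈ B.target := by
        have hcont : ContinuousAt (fun t' => γ +ᵥ (c.symm (model.symm t') : Cover)) t :=
          ((c.continuousAt_symm ht1).comp model.continuous_symm.continuousAt).const_vadd γ
        refine hcont.eventually (B.open_target.mem_nhds ?_)
        change γ +ᵥ p ∈ B.target
        rw [hγ]
        exact B.map_source ht3
      filter_upwards [nhdsWithin_le_nhds h1] with t' ht'
      simp only [OpenPartialHomeomorph.trans_symm_eq_symm_trans_symm,
        OpenPartialHomeomorph.coe_trans, Function.comp_apply, hAs]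
      rw [← hcov.map_vadd γ, ← hBs, B.right_inv ht']
      rfl
    · simp only [OpenPartialHomeomorph.trans_symm_eq_symm_trans_symm,
        OpenPartialHomeomorph.coe_trans, Function.comp_apply, hAs]
      rw [← hp, ← hγ]
      change _ = model (c' (γ +ᵥ p))
      rfl
  rintro _ _ ⟨x, rfl⟩ ⟨x', rfl⟩
  exact key _ _ _ _ rfl rfl

/-- The quotient map. -/
def q (p : Cover) : FibreProduct := Quotient.mk _ p

/-- The differential of the quotient map, in the frame `∂_z, ∂_α, ∂_s` of `ℂ × ℍ × ℍ`. -/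
def dq (p : Cover) (v : ℂ × ℂ × ℂ) : TangentSpace model (q p) := mfderiv model model q p v

/-- A smooth hermitian metric on the complex manifold `𝒳 ×_ℍ 𝒦`, i.e. a hermitian inner product,
linear in the first variable, on each holomorphic tangent space, with smooth coefficients in the
holomorphic charts. -/
structure HermitianMetric where
  inner : ∀ x : FibreProduct, TangentSpace model x → TangentSpace model x → ℂ
  add_left : ∀ x u v w, inner x (u + v) w = inner x u w + inner x v w
  smul_left : ∀ x (c : ℂ) v w, inner x (c • v) w = c * inner x v w
  conj_symm : ∀ x v w, conj (inner x w v) = inner x v w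
  pos : ∀ x v, v ≠ 0 → 0 < (inner x v v).re
  smooth : ∀ (x : FibreProduct) (v w : ℂ × ℂ × ℂ), ContDiffOn ℝ ∞
    (fun t : ℂ × ℂ × ℂ => inner ((extChartAt model x).symm t)
      (mfderiv 𝓘(ℂ, ℂ × ℂ × ℂ) model (extChartAt model x).symm t v)
      (mfderiv 𝓘(ℂ, ℂ × ℂ × ℂ) model (extChartAt model x).symm t w))
    (extChartAt model x).target

/-- The matrix of `q^* Ω` at a point of `ℂ × ℍ × ℍ`, in the frame `∂_z, ∂_α, ∂_s`. -/
def HermitianMetric.pullbackMatrix (Ω : HermitianMetric) (p : Cover) : Matrix (Fin 3) (Fin 3) ℂ :=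
  Matrix.of fun i j =>
    let e : Fin 3 → ℂ × ℂ × ℂ := ![(1, 0, 0), (0, 1, 0), (0, 0, 1)]
    Ω.inner (q p) (dq p (e i)) (dq p (e j))

/-- `h` is the horizontal lift to `𝒳 ×_ℍ 𝒦` at the point below `(z, α, s)` of the tangent vector
`v ∂_s` of `ℍ`: its component in `𝒳` is the canonical lift and its component in `𝒦` is the
Gauss-Manin lift. -/
def IsHorizontalLift (z : ℂ) (α s : ℍ) (g : KahlerMetric s) (v : ℂ)
    (h : TangentSpace model (q (z, α, s))) : Prop :=
  ∃ b β, IsCanonicalLift g v b ∧ IsGaussManinHorizontal α s β v ∧ h = dq (z, α, s) (b z, β, v)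

/-- `Ω` is the natural hermitian metric on `𝒳 ×_ℍ 𝒦`. At the point below `(z, α, s)` let `g` be the
Ricci-flat Kähler metric in the imaginary part of the class `α` on `X_s`. -/
structure IsNaturalMetric (Ω : HermitianMetric) : Prop where
  /-- On `T_{𝒳/ℍ} = T_{X_s}` the metric is `g`. -/
  relative_tangent : ∀ (z : ℂ) (α s : ℍ) (g : KahlerMetric s), g.RicciFlat →
    ImContains (kahlerClass α s) g → ∀ u u' : ℂ,
      Ω.inner (q (z, α, s)) (dq (z, α, s) (u, 0, 0)) (dq (z, α, s) (u', 0, 0)) =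
        u * conj u' * (g.coeff z : ℂ)
  /-- On `T_{𝒦/ℍ} = H^{1,1}(X_s, ℂ)` the metric is the `L²` metric of `g`-harmonic forms. -/
  cohomology : ∀ (z : ℂ) (α s : ℍ) (g : KahlerMetric s), g.RicciFlat →
    ImContains (kahlerClass α s) g → ∀ (β β' : ℂ) (f f' : smoothFunctions s),
      IsHarmonicForm g f → formClass f = constClass s β →
      IsHarmonicForm g f' → formClass f' = constClass s β' →
      Ω.inner (q (z, α, s)) (dq (z, α, s) (0, β, 0)) (dq (z, α, s) (0, β', 0)) =
        innerForms g f f'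
  /-- The sum `T_{𝒳/ℍ} ⊕ T_{𝒦/ℍ}` is orthogonal. -/
  orthogonal : ∀ (z : ℂ) (α s : ℍ) (u β : ℂ),
    Ω.inner (q (z, α, s)) (dq (z, α, s) (u, 0, 0)) (dq (z, α, s) (0, β, 0)) = 0
  /-- The horizontal lift of `T_ℍ` is orthogonal to the relative tangent bundle. -/
  horizontal_orthogonal : ∀ (z : ℂ) (α s : ℍ) (g : KahlerMetric s), g.RicciFlat →
    ImContains (kahlerClass α s) g → ∀ v h, IsHorizontalLift z α s g v h → ∀ u β : ℂ,
      Ω.inner (q (z, α, s)) h (dq (z, α, s) (u, β, 0)) = 0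
  /-- On the horizontal lift of `T_ℍ` the metric is the pullback by the Kodaira-Spencer map of the
  `L²` metric of `g`-harmonic representatives on `H¹(X_s, T_{X_s})`. -/
  horizontal : ∀ (z : ℂ) (α s : ℍ) (g : KahlerMetric s), g.RicciFlat →
    ImContains (kahlerClass α s) g → ∀ v v' h h',
      IsHorizontalLift z α s g v h → IsHorizontalLift z α s g v' h' →
      ∀ f f' : smoothFunctions s,
        IsHarmonicTangentForm g f → IsKodairaSpencer s v (tangentFormClass f) →
        IsHarmonicTangentForm g f' → IsKodairaSpencer s v' (tangentFormClass f') →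
        Ω.inner (q (z, α, s)) h h' = innerTangentForms g f f'

end EllipticFamily

end

/-!
On `X_s` the translation invariant tensors are those with constant coefficients in the frames `∂_z`,
`dz`, `dz̄`. The Ricci-flat metrics and the harmonic tensors turn out to be exactly these.

* A form with zero integral is exact (`mem_exactForms_of_integral_eq_zero`), so that a class in
  `H²(X_s, ℂ)` is determined by its period. Since the period of `kahlerClass α s` is `α`, and the
  imaginary part of the period of a complexified Kähler class is the area of a Kähler metric, the
  map `α ↦ kahlerClass α s` is a bijection of `ℍ` onto the complexified Kähler cone.
* If `g` is Ricci-flat, then `∂_z̄ log g` is antiholomorphic on `X_s`. By Liouville's and Stokes'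
  theorems it vanishes, and `log g` is constant. The period then gives `g = Im α / Im s`.
* For a constant `g` the constants are harmonic. Two harmonic representatives of one class differ
  by an exact form which is orthogonal to all exact forms, hence zero. So the harmonic forms to be
  paired are constants, and their `L²` products are explicit.
* The canonical lift of `v ∂_s` has constant `∂̄`. It therefore differs from
  `v (z - z̄) / (s - s̄) ∂_z + v ∂_s` by a holomorphic vector field on `X_s`, which is constant, and
  zero because it vanishes at the origin. The Gauss-Manin lift of `v ∂_s` is `v ∂_s` itself,
  because the periods are the coordinates `α`.

Hence the defining properties prescribe the values of a natural metric on the images of `∂_z`, `∂_α`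
and `∂_s + (z - z̄) / (s - s̄) ∂_z` under the differential of the quotient map, which gives the
uniqueness and the matrix (`IsNaturalMetric.inner_dq`). Conversely, the hermitian form `naturalForm`
on `ℂ × ℍ × ℍ` with these values is positive, smooth and invariant under the maps `g_{n,m}`, so it
descends to the quotient (`naturalMetric`).
-/

noncomputable section

namespace EllipticFamily

/-! ### Smooth dependence of integrals on parameters -/

/-- The induction on `n` differentiates under the integral sign, so the target space varies. -/
theorem contDiff_nat_intervalIntegral (E : Type) [NormedAddCommGroup E] [NormedSpace ℝ E]
    [ProperSpace E] (n : ℕ) : ∀ {F : Type} [NormedAddCommGroup F] [NormedSpace ℝ F]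
    [CompleteSpace F] {f : E × ℝ → F}, ContDiff ℝ ∞ f →
      ContDiff ℝ n fun x => ∫ t in (0 : ℝ)..1, f (x, t) := by
  induction n with
  | zero =>
    intro F _ _ _ f hf
    exact contDiff_zero.2 (intervalIntegral.continuous_parametric_intervalIntegral_of_continuous'
      (f := fun x t => f (x, t)) hf.continuous 0 1)
  | succ n ih =>
    intro F _ _ _ f hf
    have hf' : ContDiff ℝ ∞ fun p => (fderiv ℝ f p).comp (ContinuousLinearMap.inl ℝ E ℝ) :=
      (hf.fderiv_right (m := ∞) (by simp)).clm_comp contDiff_const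
    rw [Nat.cast_succ, contDiff_succ_iff_hasFDerivAt]
    refine
      ⟨fun x => ∫ t in (0 : ℝ)..1, (fderiv ℝ f (x, t)).comp (ContinuousLinearMap.inl ℝ E ℝ),
        ih (F := E →L[ℝ] F) hf', fun x₀ => ?_⟩
    -- The derivative of the integrand is bounded near `x₀`, uniformly in `t ∈ [0, 1]`.
    obtain ⟨C, hC⟩ := ((isCompact_closedBall x₀ 1).prod
      (isCompact_Icc (a := (0 : ℝ)) (b := 1))).exists_bound_of_continuousOn
        hf'.continuous.continuousOn
    refine intervalIntegral.hasFDerivAt_integral_of_dominated_of_fderiv_le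
      (F := fun x t => f (x, t)) (bound := fun _ => C)
      (s := Metric.closedBall x₀ 1)
      (F' := fun x t => (fderiv ℝ f (x, t)).comp (ContinuousLinearMap.inl ℝ E ℝ))
      (Metric.closedBall_mem_nhds x₀ one_pos) ?_ ?_ ?_ ?_ ?_ ?_
    · exact Filter.Eventually.of_forall fun x =>
        (hf.continuous.comp (Continuous.prodMk_right x)).aestronglyMeasurable
    · exact (hf.continuous.comp (Continuous.prodMk_right x₀)).intervalIntegrable _ _
    · exact (hf'.continuous.comp (Continuous.prodMk_right x₀)).aestronglyMeasurable
    · refine Filter.Eventually.of_forall fun t ht x hx => hC (x, t) ⟨hx, ?_⟩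
      rw [Set.uIoc_of_le zero_le_one] at ht
      exact Set.Ioc_subset_Icc_self ht
    · exact intervalIntegrable_const
    · refine Filter.Eventually.of_forall fun t _ x _ => ?_
      exact ((hf.differentiable (by simp)) (x, t)).hasFDerivAt.comp x (hasFDerivAt_prodMk_left x t)

theorem contDiff_intervalIntegral {E F : Type} [NormedAddCommGroup E] [NormedSpace ℝ E]
    [ProperSpace E] [NormedAddCommGroup F] [NormedSpace ℝ F] [CompleteSpace F] {f : E × ℝ → F}
    (hf : ContDiff ℝ ∞ f) : ContDiff ℝ ∞ fun x => ∫ t in (0 : ℝ)..1, f (x, t) :=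
  contDiff_infty.2 fun n => contDiff_nat_intervalIntegral E n hf

/-! ### Smooth functions on `X_s` -/

variable {s : ℍ}

/-- The smooth function on `X_s` induced by a smooth doubly periodic function on `ℂ`. -/
def descend (F : ℂ → ℂ) (hF : ContDiff ℝ ∞ F)
    (hper : ∀ (z : ℂ) (n m : ℤ), F (z + n + m * (s : ℂ)) = F z) : smoothFunctions s :=
  ⟨fun x => Quotient.liftOn' x F fun a b hab => by
      obtain ⟨n, m, h⟩ := QuotientAddGroup.leftRel_apply.1 hab
      rw [← hper a n m]
      congr 1
      linear_combination -h,
    hF⟩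

theorem descend_coe (F : ℂ → ℂ) (hF : ContDiff ℝ ∞ F)
    (hper : ∀ (z : ℂ) (n m : ℤ), F (z + n + m * (s : ℂ)) = F z) (z : ℂ) :
    (descend F hF hper).1 (z : Curve s) = F z := rfl

/-- The constant function `c` on `X_s`. -/
def constFun (s : ℍ) (c : ℂ) : smoothFunctions s :=
  ⟨fun _ => c, (contDiff_const : ContDiff ℝ ∞ fun _ : ℂ => c)⟩

theorem constFun_apply (c : ℂ) (x : Curve s) : (constFun s c).1 x = c := rfl

/-- The product of `f` and the complex conjugate of `h`. -/
def mulConj (f h : smoothFunctions s) : smoothFunctions s :=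
  ⟨fun x => f.1 x * conj (h.1 x), by
    have h1 : ContDiff ℝ ∞ fun z : ℂ => conj (h.1 z) :=
      conjCLE.contDiff.comp (show ContDiff ℝ ∞ fun z : ℂ => h.1 z from h.2)
    exact (show ContDiff ℝ ∞ fun z : ℂ => f.1 z from f.2).mul h1⟩

theorem mulConj_apply (f h : smoothFunctions s) (x : Curve s) :
    (mulConj f h).1 x = f.1 x * conj (h.1 x) := rfl

theorem contDiff_fderiv_coe (f : smoothFunctions s) (e : ℂ) :
    ContDiff ℝ ∞ fun z : ℂ => fderiv ℝ (fun w : ℂ => f.1 w) z e :=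
  (ContDiff.fderiv_right (m := ∞) (n := ∞) f.2 (by simp)).clm_apply contDiff_const

theorem fderiv_coe_add (f : smoothFunctions s) (z : ℂ) (n m : ℤ) :
    fderiv ℝ (fun w : ℂ => f.1 w) (z + n + m * (s : ℂ)) = fderiv ℝ (fun w : ℂ => f.1 w) z := by
  have h : (fun w : ℂ => f.1 w) = fun w : ℂ => f.1 ((w + (n + m * (s : ℂ)) : ℂ) : Curve s) := by
    funext w
    rw [← add_assoc, Curve.coe_add]
  conv_rhs => rw [h]
  rw [fderiv_comp_add_right (f := fun w : ℂ => f.1 w), ← add_assoc]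

/-- `∂_z̄ f`, as a smooth function on `X_s`. -/
def dbarFun (f : smoothFunctions s) : smoothFunctions s :=
  descend (dzbar fun w => f.1 w)
    (((contDiff_fderiv_coe f 1).add (contDiff_const.mul (contDiff_fderiv_coe f I))).div_const 2)
    fun z n m => by simp only [dzbar, fderiv_coe_add]

/-- Every point of `X_s` lies in the fundamental parallelogram. -/
theorem exists_coe_eq (s : ℍ) (x : Curve s) : ∃ a ∈ Set.Icc (0 : ℝ) 1, ∃ b ∈ Set.Icc (0 : ℝ) 1,
    ((a + b * (s : ℂ) : ℂ) : Curve s) = x := by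
  obtain ⟨z, rfl⟩ := QuotientAddGroup.mk_surjective x
  set y : ℝ := z.im / s.im with hy
  set u : ℝ := z.re - y * s.re with hu
  have hz : z = u + y * (s : ℂ) := by
    apply Complex.ext
    · simp [hu]
    · simp [hy, s.im_pos.ne']
  refine ⟨Int.fract u, ⟨Int.fract_nonneg _, (Int.fract_lt_one _).le⟩, Int.fract y,
    ⟨Int.fract_nonneg _, (Int.fract_lt_one _).le⟩, ?_⟩
  rw [← Curve.coe_add s _ ⌊u⌋ ⌊y⌋]
  congr 1
  conv_rhs => rw [hz, ← Int.fract_add_floor u, ← Int.fract_add_floor y]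
  push_cast
  ring

theorem isBounded_range_coe (f : smoothFunctions s) :
    Bornology.IsBounded (Set.range fun z : ℂ => f.1 z) := by
  have hc : Continuous fun p : ℝ × ℝ => f.1 ((p.1 + p.2 * (s : ℂ) : ℂ) : Curve s) :=
    (differentiable_coe f).continuous.comp (g := fun z : ℂ => f.1 z)
      (f := fun p : ℝ × ℝ => (p.1 + p.2 * (s : ℂ) : ℂ)) (by fun_prop)
  refine (((isCompact_Icc (a := (0 : ℝ)) (b := 1)).prod
    (isCompact_Icc (a := (0 : ℝ)) (b := 1))).image hc).isBounded.subset ?_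
  rintro _ ⟨z, rfl⟩
  obtain ⟨a, ha, b, hb, h⟩ := exists_coe_eq s z
  exact ⟨(a, b), ⟨ha, hb⟩, congrArg f.1 h⟩

/-- A holomorphic function on `X_s` is constant. -/
theorem eq_of_dzbar_eq_zero (f : smoothFunctions s) (h : ∀ z, dzbar (fun w => f.1 w) z = 0)
    (x y : Curve s) : f.1 x = f.1 y := by
  obtain ⟨z, rfl⟩ := QuotientAddGroup.mk_surjective x
  obtain ⟨w, rfl⟩ := QuotientAddGroup.mk_surjective y
  have hd : Differentiable ℂ fun z : ℂ => f.1 z := fun z => by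
    refine differentiableAt_complex_iff_differentiableAt_real.2 ⟨differentiable_coe f z, ?_⟩
    have h1 := h z
    simp only [dzbar] at h1
    rw [smul_eq_mul]
    linear_combination (-2 * I) * h1 + fderiv ℝ (fun w : ℂ => f.1 w) z I * I_mul_I
  exact hd.apply_eq_apply_of_bounded (isBounded_range_coe f) z w

/-! ### Integration over `X_s` -/

theorem integral_eq (f : Curve s → ℂ) : integral s f =
    (∫ y in (0 : ℝ)..1, ∫ x in (0 : ℝ)..1, f (x + y * (s : ℂ) : ℂ)) * (conj (s : ℂ) - s) := by
  simp only [integral, intervalIntegral.integral_mul_const]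

theorem integral_const_mul (c : ℂ) (f : Curve s → ℂ) :
    (integral s fun x => c * f x) = c * integral s f := by
  simp only [integral_eq, intervalIntegral.integral_const_mul, mul_assoc]

theorem integral_const (c : ℂ) : (integral s fun _ => c) = c * (conj (s : ℂ) - s) := by
  simp [integral]

theorem integral_conj (f : Curve s → ℂ) :
    (integral s fun x => conj (f x)) = -conj (integral s f) := by
  have h : ∀ F : ℝ → ℂ, ∫ t in (0 : ℝ)..1, conj (F t) = conj (∫ t in (0 : ℝ)..1, F t) := fun F => by
    simp only [intervalIntegral.integral_of_le zero_le_one]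
    exact _root_.integral_conj
  simp only [integral_eq, h, map_mul, map_sub, conj_conj]
  ring

theorem conj_sub_self_eq (s : ℍ) : conj (s : ℂ) - s = -2 * I * (s.im : ℂ) := by
  apply Complex.ext <;> simp
  ring

theorem im_ne_zero (s : ℍ) : (s.im : ℂ) ≠ 0 := ofReal_ne_zero.2 s.im_pos.ne'

theorem conj_sub_self_ne_zero (s : ℍ) : conj (s : ℂ) - s ≠ 0 := by
  rw [conj_sub_self_eq]
  exact mul_ne_zero (by simp) (im_ne_zero s)

theorem integral_add (f h : smoothFunctions s) :
    (integral s fun x => f.1 x + h.1 x) = integral s f.1 + integral s h.1 :=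
  (integralLin s).map_add f h

/-- Stokes' theorem: a `∂_z̄`-derivative has zero integral. -/
theorem integral_exactTangentForms {f : smoothFunctions s} (hf : f ∈ exactTangentForms s) :
    integral s f.1 = 0 := by
  obtain ⟨v, hv⟩ := hf
  refine exactForms_le_ker s ⟨-v, 0, fun z => ?_⟩
  have h1 : dzbar (fun w : ℂ => (-v).1 w) z = -dzbar (fun w : ℂ => v.1 w) z := by
    have := dzbar_const_mul (-1) (differentiable_coe v z)
    simpa using this
  rw [h1, hv]
  simp [dz]

/-- If `∂_z̄ f` is constant then `f` is constant, by Stokes' theorem and Liouville's theorem. -/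
theorem eq_of_dzbar_eq_const (f : smoothFunctions s) {c : ℂ}
    (h : ∀ z, dzbar (fun w => f.1 w) z = c) : c = 0 ∧ ∀ x y : Curve s, f.1 x = f.1 y := by
  have hc : c = 0 := by
    have h1 := integral_exactTangentForms (f := constFun s c) ⟨f, fun z => (h z).symm⟩
    change (integral s fun _ => c) = 0 at h1
    rw [integral_const] at h1
    exact (mul_eq_zero.1 h1).resolve_right (conj_sub_self_ne_zero s)
  exact ⟨hc, eq_of_dzbar_eq_zero f fun z => (h z).trans hc⟩

theorem integral_ofReal_pos {f : Curve s → ℝ} (hf : Continuous fun z : ℂ => f z)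
    (h0 : ∀ x, 0 ≤ f x) {x₀ : Curve s} (hx₀ : 0 < f x₀) :
    0 < ∫ y in (0 : ℝ)..1, ∫ x in (0 : ℝ)..1, f (x + y * (s : ℂ) : ℂ) := by
  have hc : Continuous fun p : ℝ × ℝ => f ((p.2 + p.1 * (s : ℂ) : ℂ) : Curve s) :=
    hf.comp (g := fun z : ℂ => f z) (f := fun p : ℝ × ℝ => (p.2 + p.1 * (s : ℂ) : ℂ))
      (by fun_prop)
  obtain ⟨a, ha, b, hb, h⟩ := exists_coe_eq s x₀
  have hn : ∀ y : ℝ, 0 ≤ ∫ x in (0 : ℝ)..1, f (x + y * (s : ℂ) : ℂ) := fun y =>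
    intervalIntegral.integral_nonneg zero_le_one fun x _ => h0 _
  refine intervalIntegral.integral_pos one_pos ?_ (fun y _ => hn y) ⟨b, hb, ?_⟩
  · exact (intervalIntegral.continuous_parametric_intervalIntegral_of_continuous'
      (f := fun y x : ℝ => f ((x + y * (s : ℂ) : ℂ) : Curve s)) hc 0 1).continuousOn
  · exact intervalIntegral.integral_pos one_pos
      (hc.comp (Continuous.prodMk_right b)).continuousOn (fun x _ => h0 _) ⟨a, ha, by rwa [h]⟩

theorem integral_ofReal (f : Curve s → ℝ) : (integral s fun x => (f x : ℂ)) =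
    ((∫ y in (0 : ℝ)..1, ∫ x in (0 : ℝ)..1, f (x + y * (s : ℂ) : ℂ) : ℝ) : ℂ) *
      (conj (s : ℂ) - s) := by
  simp only [integral_eq, intervalIntegral.integral_ofReal]

/-- The `L²` product of functions is definite. -/
theorem eq_zero_of_integral_mulConj {f : smoothFunctions s}
    (h : integral s (mulConj f f).1 = 0) : f = 0 := by
  by_contra hne
  have hx : ∃ x, f.1 x ≠ 0 := by
    by_contra! hx
    exact hne (Subtype.ext (funext hx))
  obtain ⟨x, hx⟩ := hx
  have h1 : (mulConj f f).1 = fun x => ((normSq (f.1 x) : ℝ) : ℂ) := by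
    funext x
    rw [mulConj_apply, mul_conj]
  rw [h1, integral_ofReal] at h
  have h2 := (mul_eq_zero.1 h).resolve_right (conj_sub_self_ne_zero s)
  have h3 := integral_ofReal_pos (s := s) (f := fun x => normSq (f.1 x))
    (continuous_normSq.comp (differentiable_coe f).continuous) (fun x => normSq_nonneg _)
    (normSq_pos.2 hx)
  exact h3.ne' (ofReal_eq_zero.1 h2)

/-! ### Second cohomology of `X_s` -/

/-- A doubly periodic smooth function in the lattice coordinates `z = x + y s` induces a smooth
function on `X_s`. -/
def ofPeriodic (s : ℍ) (A : ℝ × ℝ → ℂ) (hA : ContDiff ℝ ∞ A)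
    (h1 : ∀ x y, A (x + 1, y) = A (x, y)) (h2 : ∀ x y, A (x, y + 1) = A (x, y)) :
    smoothFunctions s :=
  descend (fun z => A (z.re - z.im / s.im * s.re, z.im / s.im))
    (hA.comp (((reCLM.contDiff).sub (((imCLM.contDiff).div_const _).mul contDiff_const)).prodMk
      ((imCLM.contDiff).div_const _))) fun z n m => by
    have e1 : (z + n + m * (s : ℂ)).im / s.im = z.im / s.im + m := by
      simp [add_div, s.im_pos.ne']
    have e2 : (z + n + m * (s : ℂ)).re = z.re + n + m * s.re := by simp
    have p1 : ∀ (n : ℤ) x y, A (x + n, y) = A (x, y) := fun n x y => by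
      have : Function.Periodic (fun x => A (x, y)) 1 := fun x => h1 x y
      simpa using this.int_mul n x
    have p2 : ∀ (n : ℤ) x y, A (x, y + n) = A (x, y) := fun n x y => by
      have : Function.Periodic (fun y => A (x, y)) 1 := fun y => h2 x y
      simpa using this.int_mul n y
    rw [e1, e2, p2, ← p1 n (z.re - z.im / s.im * s.re)]
    congr 2
    ring

theorem ofPeriodic_coe {A : ℝ × ℝ → ℂ} (hA : ContDiff ℝ ∞ A)
    (h1 : ∀ x y, A (x + 1, y) = A (x, y)) (h2 : ∀ x y, A (x, y + 1) = A (x, y)) (x y : ℝ) :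
    (ofPeriodic s A hA h1 h2).1 ((x + y * (s : ℂ) : ℂ) : Curve s) = A (x, y) := by
  refine (descend_coe _ _ _ _).trans ?_
  have : (x + y * (s : ℂ)).im / s.im = y := by simp [s.im_pos.ne']
  rw [this]
  simp

/-- If `∂A/∂x + ∂B/∂y = f` in the lattice coordinates `z = x + y s`, with `A` and `B` smooth
functions on `X_s`, then the form `f dz ∧ dz̄` is exact. -/
theorem mem_exactForms_of_hasDerivAt {f A B : smoothFunctions s} {F G : ℂ → ℂ}
    (hA : ∀ x y : ℝ, HasDerivAt (fun t : ℝ => A.1 ((t + y * (s : ℂ) : ℂ) : Curve s))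
      (F (x + y * (s : ℂ))) x)
    (hB : ∀ x y : ℝ, HasDerivAt (fun t : ℝ => B.1 ((x + t * (s : ℂ) : ℂ) : Curve s))
      (G (x + y * (s : ℂ))) y)
    (hf : ∀ z : ℂ, f.1 z = F z + G z) : f ∈ exactForms s := by
  refine ⟨-(A + conj (s : ℂ) • B), A + (s : ℂ) • B, fun z => ?_⟩
  obtain ⟨x, y, rfl⟩ : ∃ x y : ℝ, z = x + y * (s : ℂ) := by
    refine ⟨z.re - z.im / s.im * s.re, z.im / s.im, Complex.ext ?_ ?_⟩
    · simp
    · simp [s.im_pos.ne']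
  have h1 : fderiv ℝ (fun w : ℂ => A.1 w) (x + y * (s : ℂ)) 1 = F (x + y * (s : ℂ)) := by
    have h : HasDerivAt (fun t : ℝ => (t : ℂ) + y * (s : ℂ)) 1 x :=
      (ofRealCLM.hasDerivAt (x := x)).add_const _
    have h' : HasDerivAt (fun t : ℝ => A.1 ((t + y * (s : ℂ) : ℂ) : Curve s))
        (fderiv ℝ (fun w : ℂ => A.1 w) (x + y * (s : ℂ)) 1) x :=
      (differentiable_coe A _).hasFDerivAt.comp_hasDerivAt x h
    exact h'.unique (hA x y)
  have h2 : fderiv ℝ (fun w : ℂ => B.1 w) (x + y * (s : ℂ)) s = G (x + y * (s : ℂ)) := by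
    have h : HasDerivAt (fun t : ℝ => (x : ℂ) + t * (s : ℂ)) s y := by
      simpa using ((ofRealCLM.hasDerivAt (x := y)).mul_const (s : ℂ)).const_add (x : ℂ)
    have h' : HasDerivAt (fun t : ℝ => B.1 ((x + t * (s : ℂ) : ℂ) : Curve s))
        (fderiv ℝ (fun w : ℂ => B.1 w) (x + y * (s : ℂ)) s) y :=
      (differentiable_coe B _).hasFDerivAt.comp_hasDerivAt y h
    exact h'.unique (hB x y)
  generalize (x : ℂ) + y * (s : ℂ) = z at h1 h2 ⊢
  have dA := differentiable_coe A z
  have dB := differentiable_coe B z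
  have h3 : fderiv ℝ (fun w : ℂ => B.1 w) z s = (s.re : ℂ) * fderiv ℝ (fun w : ℂ => B.1 w) z 1 +
      (s.im : ℂ) * fderiv ℝ (fun w : ℂ => B.1 w) z I := by
    have : (s : ℂ) = s.re • (1 : ℂ) + s.im • I := by
      apply Complex.ext <;> simp
    conv_lhs => rw [this, map_add, map_smul, map_smul]
    simp
  have h4 : dz (fun w : ℂ => (A + (s : ℂ) • B).1 w) z =
      dz (fun w : ℂ => A.1 w) z + s * dz (fun w : ℂ => B.1 w) z := by
    rw [← dz_const_mul _ dB, ← dz_add dA (dB.const_mul _)]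
    rfl
  have h5 : dzbar (fun w : ℂ => (-(A + conj (s : ℂ) • B)).1 w) z =
      -(dzbar (fun w : ℂ => A.1 w) z + conj (s : ℂ) * dzbar (fun w : ℂ => B.1 w) z) := by
    have h := dzbar_const_mul (-1) (dA.fun_add (dB.const_mul (conj (s : ℂ))))
    rw [dzbar_add dA (dB.const_mul _), dzbar_const_mul _ dB, neg_one_mul] at h
    simp only [neg_one_mul] at h
    exact h
  have h6 : (s : ℂ) = s.re + s.im * I := by
    apply Complex.ext <;> simp
  have h7 : conj (s : ℂ) = s.re - s.im * I := by
    apply Complex.ext <;> simp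
  rw [h4, h5, hf, ← h1, ← h2, h3, h7, h6]
  simp only [dz, dzbar]
  linear_combination ((s.im : ℂ) * fderiv ℝ (fun w : ℂ => B.1 w) z I) * I_mul_I

/-- A 2-form on `X_s` with zero integral is exact. In lattice coordinates
`f(x, y) = (f(x, y) - h(y)) + h(y)` with `h(y) = ∫₀¹ f(t, y) dt`; the first summand has mean value
zero in `x` and the second in `y`, so both have periodic primitives. -/
theorem mem_exactForms_of_integral_eq_zero {f : smoothFunctions s} (hf : integral s f.1 = 0) :
    f ∈ exactForms s := by
  set F : ℝ × ℝ → ℂ := fun p => f.1 ((p.1 + p.2 * (s : ℂ) : ℂ) : Curve s) with hF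
  have hFs : ContDiff ℝ ∞ F :=
    (show ContDiff ℝ ∞ fun z : ℂ => f.1 z from f.2).comp
      ((ofRealCLM.contDiff.comp contDiff_fst).add
        ((ofRealCLM.contDiff.comp contDiff_snd).mul contDiff_const))
  have F1 : ∀ x y, F (x + 1, y) = F (x, y) := fun x y => by
    have := Curve.coe_add s (x + y * (s : ℂ)) 1 0
    simp only [hF]
    rw [← this]
    refine congrArg (fun z : ℂ => f.1 z) ?_
    push_cast
    ring
  have F2 : ∀ x y, F (x, y + 1) = F (x, y) := fun x y => by
    have := Curve.coe_add s (x + y * (s : ℂ)) 0 1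
    simp only [hF]
    rw [← this]
    refine congrArg (fun z : ℂ => f.1 z) ?_
    push_cast
    ring
  set h : ℝ → ℂ := fun y => ∫ t in (0 : ℝ)..1, F (t, y) with hh
  have hhs : ContDiff ℝ ∞ h :=
    contDiff_intervalIntegral (f := fun p : ℝ × ℝ => F (p.2, p.1))
      (hFs.comp (contDiff_snd.prodMk contDiff_fst))
  have h2 : ∀ y, h (y + 1) = h y := fun y => by simp only [hh, F2]
  have hint : ∫ y in (0 : ℝ)..1, h y = 0 := by
    rw [integral_eq] at hf
    exact (mul_eq_zero.1 hf).resolve_right (conj_sub_self_ne_zero s)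
  -- The primitives `∫₀ˣ` are written as `x ∫₀¹ (x t)` to see that they are smooth.
  have prim : ∀ (u : ℝ → ℂ) (x : ℝ), x * ∫ t in (0 : ℝ)..1, u (x * t) = ∫ t in (0 : ℝ)..x, u t :=
    fun u x => by
      have := intervalIntegral.smul_integral_comp_mul_left (a := 0) (b := 1) u x
      rwa [mul_zero, mul_one, real_smul] at this
  set A : ℝ × ℝ → ℂ := fun p => p.1 * ∫ t in (0 : ℝ)..1, (F (p.1 * t, p.2) - h p.2) with hA
  have hAs : ContDiff ℝ ∞ A := by
    refine (ofRealCLM.contDiff.comp contDiff_fst).mul (contDiff_intervalIntegral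
      (f := fun p : (ℝ × ℝ) × ℝ => F (p.1.1 * p.2, p.1.2) - h p.1.2) ?_)
    exact (hFs.comp (((contDiff_fst.comp contDiff_fst).mul contDiff_snd).prodMk
      (contDiff_snd.comp contDiff_fst))).sub (hhs.comp (contDiff_snd.comp contDiff_fst))
  have hAeq : ∀ x y, A (x, y) = ∫ t in (0 : ℝ)..x, (F (t, y) - h y) := fun x y =>
    prim (fun t => F (t, y) - h y) x
  have cF : ∀ y, Continuous fun t => F (t, y) - h y := fun y =>
    (hFs.continuous.comp (Continuous.prodMk_left y)).sub continuous_const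
  set B : ℝ × ℝ → ℂ := fun p => p.2 * ∫ t in (0 : ℝ)..1, h (p.2 * t) with hB
  have hBs : ContDiff ℝ ∞ B := by
    refine (ofRealCLM.contDiff.comp contDiff_snd).mul (contDiff_intervalIntegral
      (f := fun p : (ℝ × ℝ) × ℝ => h (p.1.2 * p.2)) ?_)
    exact hhs.comp ((contDiff_snd.comp contDiff_fst).mul contDiff_snd)
  have hBeq : ∀ x y, B (x, y) = ∫ t in (0 : ℝ)..y, h t := fun x y => prim h y
  have A1 : ∀ x y, A (x + 1, y) = A (x, y) := fun x y => by
    have hp : Function.Periodic (fun t => F (t, y) - h y) 1 := fun t => by simp only [F1]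
    rw [hAeq, hAeq, hp.intervalIntegral_add_eq_add 0 x fun a b => (cF y).intervalIntegrable a b]
    simp only [zero_add]
    have h0 : ∫ t in (0 : ℝ)..1, (F (t, y) - h y) = 0 := by
      have i1 : IntervalIntegrable (fun t => F (t, y)) MeasureTheory.volume 0 1 :=
        (hFs.continuous.comp (Continuous.prodMk_left y)).intervalIntegrable _ _
      rw [intervalIntegral.integral_sub i1 (by simp)]
      simp [hh]
    rw [h0, add_zero]
  have A2 : ∀ x y, A (x, y + 1) = A (x, y) := fun x y => by simp only [hAeq, F2, h2]
  have B1 : ∀ x y, B (x + 1, y) = B (x, y) := fun x y => rfl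
  have B2 : ∀ x y, B (x, y + 1) = B (x, y) := fun x y => by
    have hp : Function.Periodic h 1 := h2
    rw [hBeq, hBeq, hp.intervalIntegral_add_eq_add 0 y
      fun a b => hhs.continuous.intervalIntegrable a b]
    simp only [zero_add, hint, add_zero]
  have hcoord : ∀ x y : ℝ, ((x : ℂ) + y * (s : ℂ)).im / s.im = y := fun x y => by
    simp [s.im_pos.ne']
  refine mem_exactForms_of_hasDerivAt (A := ofPeriodic s A hAs A1 A2)
    (B := ofPeriodic s B hBs B1 B2) (F := fun z => f.1 z - h (z.im / s.im))
    (G := fun z => h (z.im / s.im)) (fun x y => ?_) (fun x y => ?_) (fun z => by ring)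
  · simp only [ofPeriodic_coe, hcoord, hAeq]
    exact intervalIntegral.integral_hasDerivAt_right ((cF y).intervalIntegrable _ _)
      ((cF y).stronglyMeasurableAtFilter _ _) (cF y).continuousAt
  · simp only [ofPeriodic_coe, hcoord, hBeq]
    exact intervalIntegral.integral_hasDerivAt_right (hhs.continuous.intervalIntegrable _ _)
      (hhs.continuous.stronglyMeasurableAtFilter _ _) hhs.continuous.continuousAt

theorem period_formClass (f : smoothFunctions s) : period s (formClass f) = integral s f.1 := rfl

theorem period_constClass (a : ℂ) : period s (constClass s a) = a := by
  change (integral s fun _ => a / (s.im : ℂ) * (I / 2)) = a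
  rw [integral_const, conj_sub_self_eq]
  have := im_ne_zero s
  field_simp
  linear_combination -a * I_sq

/-- The period identifies `H²(X_s, ℂ)` with `ℂ`. -/
theorem eq_constClass_period (κ : H11 s) : κ = constClass s (period s κ) := by
  obtain ⟨f, rfl⟩ := (exactForms s).mkQ_surjective κ
  set c : smoothFunctions s := constFun s (period s (formClass f) / (s.im : ℂ) * (I / 2)) with hc
  refine (Submodule.Quotient.eq (exactForms s)).2 (mem_exactForms_of_integral_eq_zero ?_)
  change integralLin s (f - c) = 0
  rw [map_sub, sub_eq_zero]
  change period s (formClass f) = period s (constClass s (period s (formClass f)))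
  rw [period_constClass]

theorem add_conj_eq_of_im_eq {g : KahlerMetric s} {f : smoothFunctions s} {x : Curve s}
    (h : (f.1 x - -conj (f.1 x)) / (2 * I) = I / 2 * (g.coeff x : ℂ)) :
    f.1 x + conj (f.1 x) = -(g.coeff x : ℂ) := by
  have : (2 * I : ℂ) ≠ 0 := by simp
  rw [div_eq_iff this] at h
  linear_combination h + (g.coeff x : ℂ) * I_sq

/-- The period of the imaginary part of a class determines the area of a Kähler metric whose Kähler
form it contains. -/
theorem ImContains.period_sub_conj {κ : H11 s} {g : KahlerMetric s} (h : ImContains κ g) :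
    period s κ - conj (period s κ) = 2 * I * s.im *
      ((∫ y in (0 : ℝ)..1, ∫ x in (0 : ℝ)..1, g.coeff (x + y * (s : ℂ) : ℂ) : ℝ) : ℂ) := by
  obtain ⟨f, rfl, hf⟩ := h
  have h1 : (integral s fun x => (g.coeff x : ℂ)) =
      (integral s fun x => (-1 : ℂ) * (f.1 x + (mulConj (constFun s 1) f).1 x)) := by
    congr 1
    funext x
    rw [mulConj_apply, constFun_apply, one_mul, add_conj_eq_of_im_eq (hf x)]
    ring
  have h2 : integral s (mulConj (constFun s 1) f).1 = -conj (integral s f.1) := by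
    rw [← integral_conj]
    congr 1
    funext x
    rw [mulConj_apply, constFun_apply, one_mul]
  rw [integral_const_mul, integral_add, h2, integral_ofReal, conj_sub_self_eq] at h1
  rw [period_formClass]
  linear_combination h1

/-! ### Ricci-flat metrics -/

/-- The Kähler metric with constant coefficient `Im α / Im s`. -/
def flatMetric (α s : ℍ) : KahlerMetric s where
  coeff _ := α.im / s.im
  smooth := contDiff_const
  pos _ := div_pos α.im_pos s.im_pos

theorem flatMetric_ricciFlat (α s : ℍ) : (flatMetric α s).RicciFlat := fun z => by
  have : (dzbar fun w : ℂ => (Real.log ((flatMetric α s).coeff w) : ℂ)) = fun _ => 0 := by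
    funext w
    simp [flatMetric, dzbar]
  rw [this]
  simp [dz]

theorem flatMetric_imContains (α s : ℍ) : ImContains (kahlerClass α s) (flatMetric α s) := by
  refine ⟨constFun s (α / (s.im : ℂ) * (I / 2)), rfl, fun x => ?_⟩
  simp only [constFun_apply, flatMetric, map_mul, map_div₀, conj_ofReal, conj_I, ofReal_div]
  have h : conj (α : ℂ) = α - 2 * I * α.im := by
    linear_combination conj_sub_self_eq α
  have h2 : conj (2 : ℂ) = 2 := conj_ofReal 2
  rw [h, h2]
  have := im_ne_zero s
  field_simp
  ring

theorem dzbar_conj (f : ℂ → ℂ) (hf : Differentiable ℝ f) (z : ℂ) :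
    dzbar (fun w => conj (f w)) z = conj (dz f z) := by
  have h : fderiv ℝ (fun w => conj (f w)) z = conjCLE.toContinuousLinearMap.comp (fderiv ℝ f z) :=
    (conjCLE.toContinuousLinearMap.hasFDerivAt.comp z (hf z).hasFDerivAt).fderiv
  have h2 : conj (2 : ℂ) = 2 := conj_ofReal 2
  simp [dz, dzbar, h, h2]

/-- A Ricci-flat Kähler metric on `X_s` has constant coefficient: `∂_z̄ log g` is antiholomorphic
on `X_s`, hence constant, hence zero, so that `log g` is holomorphic, hence constant. -/
theorem KahlerMetric.RicciFlat.coeff_eq {g : KahlerMetric s} (hg : g.RicciFlat)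
    (x y : Curve s) : g.coeff x = g.coeff y := by
  have hs : ContDiff ℝ ∞ fun z : ℂ => ((Real.log (g.coeff z) : ℝ) : ℂ) :=
    ofRealCLM.contDiff.comp (g.smooth.log fun z => (g.pos z).ne')
  set φ : smoothFunctions s := ⟨fun x => (Real.log (g.coeff x) : ℂ), hs⟩ with hφ
  -- `mulConj (constFun s 1)` is complex conjugation, so this says that the conjugate of
  -- `∂_z̄ log g` is holomorphic.
  have h1 : ∀ z, dzbar (fun w : ℂ => (mulConj (constFun s 1) (dbarFun φ)).1 w) z = 0 := fun z => by
    have : (fun w : ℂ => (mulConj (constFun s 1) (dbarFun φ)).1 w) =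
        fun w : ℂ => conj ((dbarFun φ).1 w) := by
      funext w
      rw [mulConj_apply, constFun_apply, one_mul]
    rw [this, dzbar_conj _ (differentiable_coe _)]
    exact (congrArg conj (hg z)).trans (map_zero _)
  have h2 : ∀ z, dzbar (fun w : ℂ => φ.1 w) z = dzbar (fun w : ℂ => φ.1 w) 0 := fun z => by
    have := eq_of_dzbar_eq_zero _ h1 z (0 : ℂ)
    rw [mulConj_apply, mulConj_apply, constFun_apply, constFun_apply, one_mul, one_mul] at this
    exact conjCLE.injective this
  have h3 : (Real.log (g.coeff x) : ℂ) = Real.log (g.coeff y) := (eq_of_dzbar_eq_const φ h2).2 x y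
  exact Real.log_injOn_pos (g.pos x) (g.pos y) (ofReal_injective h3)

theorem coeff_eq_of_imContains {α : ℍ} {g : KahlerMetric s} (hg : g.RicciFlat)
    (h : ImContains (kahlerClass α s) g) (x : Curve s) : g.coeff x = α.im / s.im := by
  have h1 := h.period_sub_conj
  simp only [kahlerClass, period_constClass, hg.coeff_eq _ x] at h1
  have h2 := conj_sub_self_eq α
  rw [eq_div_iff s.im_pos.ne', ← ofReal_inj]
  have h3 : (2 * I : ℂ) ≠ 0 := by simp
  refine mul_left_cancel₀ h3 ?_
  simp only [intervalIntegral.integral_const, sub_zero, one_smul] at h1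
  push_cast
  linear_combination -h1 - h2

/-- The constant forms represent each complexified Kähler class exactly once. -/
theorem bijOn_kahlerClass (s : ℍ) :
    Set.BijOn (fun α : ℍ => kahlerClass α s) Set.univ (complexifiedKahlerCone s) := by
  refine ⟨fun α _ => ⟨flatMetric α s, flatMetric_imContains α s⟩, fun α _ β _ h => ?_, ?_⟩
  · have := congrArg (period s) h
    simp only [kahlerClass, period_constClass] at this
    exact UpperHalfPlane.ext this
  · rintro κ ⟨g, hg⟩
    have h1 := hg.period_sub_conj
    have h2 := integral_ofReal_pos (s := s) (f := g.coeff) g.smooth.continuous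
      (fun x => (g.pos x).le) (g.pos 0)
    have h3 : 0 < (period s κ).im := by
      have h4 := congrArg Complex.im h1
      simp only [sub_im, conj_im, mul_im, mul_re, re_ofNat, im_ofNat, I_re, I_im, ofReal_re,
        ofReal_im] at h4
      have := mul_pos s.im_pos h2
      nlinarith
    exact ⟨⟨period s κ, h3⟩, trivial, (eq_constClass_period κ).symm⟩

/-! ### Harmonic representatives -/

theorem integral_mulConj_const (f : smoothFunctions s) (c : ℂ) :
    integral s (mulConj f (constFun s c)).1 = conj c * integral s f.1 := by
  rw [← integral_const_mul]
  congr 1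
  funext x
  rw [mulConj_apply, constFun_apply, mul_comm]

theorem integral_const_mulConj (f : smoothFunctions s) (c : ℂ) :
    integral s (mulConj (constFun s c) f).1 = -(c * conj (integral s f.1)) := by
  have h : integral s (mulConj (constFun s c) f).1 = integral s fun x => c * conj (f.1 x) := rfl
  rw [h, integral_const_mul, integral_conj]
  ring

theorem innerForms_eq {g : KahlerMetric s} {γ : ℝ} (hγ : 0 < γ) (hg : ∀ x, g.coeff x = γ)
    (f h : smoothFunctions s) :
    innerForms g f h = I / 2 * (γ : ℂ)⁻¹ * integral s (mulConj f h).1 := by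
  rw [← integral_const_mul]
  have : (γ : ℂ) ≠ 0 := ofReal_ne_zero.2 hγ.ne'
  simp only [innerForms, hg]
  congr 1
  funext x
  rw [mulConj_apply]
  field_simp

theorem innerTangentForms_eq {g : KahlerMetric s} {γ : ℝ} (hγ : 0 < γ) (hg : ∀ x, g.coeff x = γ)
    (f h : smoothFunctions s) :
    innerTangentForms g f h = I / 2 * γ * integral s (mulConj f h).1 := by
  rw [← integral_const_mul]
  have : (γ : ℂ) ≠ 0 := ofReal_ne_zero.2 hγ.ne'
  simp only [innerTangentForms, hg]
  congr 1
  funext x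
  rw [mulConj_apply]
  field_simp

/-- If `f` is orthogonal to a space `V` of functions with zero integral and differs from the
constant `c` by an element of `V`, then `f = c`. -/
theorem eq_constFun_of_orthogonal {V : Submodule ℂ (smoothFunctions s)}
    (hV : ∀ e ∈ V, integral s e.1 = 0) {f : smoothFunctions s} {c : ℂ}
    (hf : ∀ e ∈ V, integral s (mulConj f e).1 = 0) (hc : f - constFun s c ∈ V) :
    f = constFun s c := by
  refine sub_eq_zero.1 (eq_zero_of_integral_mulConj ?_)
  have h : (mulConj (f - constFun s c) (f - constFun s c)).1 = fun x =>
      (mulConj f (f - constFun s c)).1 x + (mulConj (constFun s (-c)) (f - constFun s c)).1 x := by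
    funext x
    simp only [mulConj_apply, constFun_apply]
    have : (f - constFun s c).1 x = f.1 x - c := rfl
    rw [this]
    ring
  rw [h, integral_add, hf _ hc, integral_const_mulConj, hV _ hc]
  simp

theorem isHarmonicForm_constFun {g : KahlerMetric s} {γ : ℝ} (hγ : 0 < γ)
    (hg : ∀ x, g.coeff x = γ) (c : ℂ) : IsHarmonicForm g (constFun s c) := fun e he => by
  have : integral s e.1 = 0 := exactForms_le_ker s he
  rw [innerForms_eq hγ hg, integral_const_mulConj, this]
  simp

theorem isHarmonicTangentForm_constFun {g : KahlerMetric s} {γ : ℝ} (hγ : 0 < γ)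
    (hg : ∀ x, g.coeff x = γ) (c : ℂ) : IsHarmonicTangentForm g (constFun s c) := fun e he => by
  rw [innerTangentForms_eq hγ hg, integral_const_mulConj, integral_exactTangentForms he]
  simp

theorem IsHarmonicForm.eq_constFun {g : KahlerMetric s} {γ : ℝ} (hγ : 0 < γ)
    (hg : ∀ x, g.coeff x = γ) {f : smoothFunctions s} (hf : IsHarmonicForm g f) {β : ℂ}
    (hβ : formClass f = constClass s β) : f = constFun s (β / (s.im : ℂ) * (I / 2)) := by
  refine eq_constFun_of_orthogonal (V := exactForms s) (fun e he => exactForms_le_ker s he)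
    (fun e he => ?_) ((Submodule.Quotient.eq _).1 hβ)
  have h := hf e he
  rw [innerForms_eq hγ hg] at h
  exact (mul_eq_zero.1 h).resolve_left (by simp [hγ.ne'])

theorem IsHarmonicTangentForm.eq_constFun {g : KahlerMetric s} {γ : ℝ} (hγ : 0 < γ)
    (hg : ∀ x, g.coeff x = γ) {f : smoothFunctions s} (hf : IsHarmonicTangentForm g f) {c : ℂ}
    (hc : f - constFun s c ∈ exactTangentForms s) : f = constFun s c := by
  refine eq_constFun_of_orthogonal (V := exactTangentForms s)
    (fun e he => integral_exactTangentForms he) (fun e he => ?_) hc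
  have h := hf e he
  rw [innerTangentForms_eq hγ hg] at h
  exact (mul_eq_zero.1 h).resolve_left (by simp [hγ.ne'])

/-! ### The canonical lift and the Gauss-Manin connection -/

/-- Invariance of `b ∂_z + v ∂_s` under the differentials of the `g_{n,m}`, made explicit. -/
theorem isSmoothLift_iff {v : ℂ} {b : ℂ → ℂ} : IsSmoothLift s v b ↔
    ContDiff ℝ ∞ b ∧ ∀ (z : ℂ) (n m : ℤ), b (z + n + m * (s : ℂ)) = b z + m * v := by
  refine and_congr_right fun _ => forall₃_congr fun z n m => ?_
  have h : HasFDerivAt (𝕜 := ℂ) (fun w : ℂ × ℂ => (w.1 + n + m * w.2, w.2))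
      (((ContinuousLinearMap.fst ℂ ℂ ℂ) + (m : ℂ) • (ContinuousLinearMap.snd ℂ ℂ ℂ)).prod
        (ContinuousLinearMap.snd ℂ ℂ ℂ)) (z, (s : ℂ)) :=
    ((hasFDerivAt_fst.add_const _).add (hasFDerivAt_snd.const_mul _)).prodMk hasFDerivAt_snd
  rw [h.fderiv]
  simp [eq_comm]

/-- The canonical lift `v (z - z̄) / (s - s̄) ∂_z + v ∂_s` of `v ∂_s`. -/
def canonicalLift (s : ℍ) (v : ℂ) (z : ℂ) : ℂ := v / ((s : ℂ) - conj (s : ℂ)) * (z - conj z)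

theorem isSmoothLift_canonicalLift (v : ℂ) : IsSmoothLift s v (canonicalLift s v) := by
  refine isSmoothLift_iff.2 ⟨contDiff_const.mul (contDiff_id.sub conjCLE.contDiff),
    fun z n m => ?_⟩
  have : (s : ℂ) - conj (s : ℂ) ≠ 0 := by
    rw [← neg_sub]
    exact neg_ne_zero.2 (conj_sub_self_ne_zero s)
  simp only [canonicalLift, map_add, map_mul, map_intCast]
  field_simp
  ring

theorem differentiable_canonicalLift (v : ℂ) : Differentiable ℝ (canonicalLift s v) :=
  (isSmoothLift_canonicalLift v).1.differentiable (by simp)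

theorem dzbar_canonicalLift (v z : ℂ) :
    dzbar (canonicalLift s v) z = -(v / ((s : ℂ) - conj (s : ℂ))) := by
  have h : HasFDerivAt (𝕜 := ℝ) (canonicalLift s v) ((v / ((s : ℂ) - conj (s : ℂ))) •
      (ContinuousLinearMap.id ℝ ℂ - conjCLE.toContinuousLinearMap)) z :=
    ((hasFDerivAt_id z).sub conjCLE.toContinuousLinearMap.hasFDerivAt).const_mul _
  simp only [dzbar, h.fderiv]
  simp
  linear_combination (v / ((s : ℂ) - conj (s : ℂ))) * I_sq

theorem isDbarOfLift_canonicalLift (v : ℂ) : IsDbarOfLift s (canonicalLift s v)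
    (constFun s (-(v / ((s : ℂ) - conj (s : ℂ))))) := fun z => (dzbar_canonicalLift v z).symm

/-- Two lifts of the same tangent vector differ by a vector field on `X_s`. -/
theorem IsSmoothLift.exists_eq_add {v : ℂ} {b : ℂ → ℂ} (hb : IsSmoothLift s v b) :
    ∃ u : smoothFunctions s, ∀ z : ℂ, b z = u.1 z + canonicalLift s v z := by
  obtain ⟨h1, h2⟩ := isSmoothLift_iff.1 hb
  obtain ⟨h3, h4⟩ := isSmoothLift_iff.1 (isSmoothLift_canonicalLift (s := s) v)
  refine ⟨descend (fun z => b z - canonicalLift s v z) (h1.sub h3)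
    fun z n m => by rw [h2, h4]; ring, fun z => ?_⟩
  rw [descend_coe]
  ring

theorem IsDbarOfLift.sub_constFun {v : ℂ} {b : ℂ → ℂ} {f u : smoothFunctions s}
    (hf : IsDbarOfLift s b f) (hu : ∀ z : ℂ, b z = u.1 z + canonicalLift s v z) (z : ℂ) :
    (f - constFun s (-(v / ((s : ℂ) - conj (s : ℂ))))).1 z = dzbar (fun w => u.1 w) z := by
  have h : dzbar b z = dzbar (fun w => u.1 w) z + dzbar (canonicalLift s v) z := by
    rw [funext hu]
    exact dzbar_add (differentiable_coe u z) (differentiable_canonicalLift v z)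
  have h' : (f - constFun s (-(v / ((s : ℂ) - conj (s : ℂ))))).1 z =
      f.1 z - -(v / ((s : ℂ) - conj (s : ℂ))) := rfl
  rw [h', hf z, h, dzbar_canonicalLift]
  ring

theorem isCanonicalLift_canonicalLift {g : KahlerMetric s} {γ : ℝ} (hγ : 0 < γ)
    (hg : ∀ x, g.coeff x = γ) (v : ℂ) : IsCanonicalLift g v (canonicalLift s v) :=
  ⟨isSmoothLift_canonicalLift v, ⟨_, isDbarOfLift_canonicalLift v,
    isHarmonicTangentForm_constFun hγ hg _⟩, by simp [canonicalLift]⟩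

/-- The canonical lift is unique: its `∂̄` is the constant harmonic representative, so it differs
from `canonicalLift` by a holomorphic, hence constant, vector field, which vanishes at `0`. -/
theorem IsCanonicalLift.eq_canonicalLift {g : KahlerMetric s} {γ : ℝ} (hγ : 0 < γ)
    (hg : ∀ x, g.coeff x = γ) {v : ℂ} {b : ℂ → ℂ} (hb : IsCanonicalLift g v b) :
    b = canonicalLift s v := by
  obtain ⟨hb, ⟨f, hf, hh⟩, h0⟩ := hb
  obtain ⟨u, hu⟩ := hb.exists_eq_add
  have hfu := hf.sub_constFun hu
  have hfc := hh.eq_constFun hγ hg ⟨u, hfu⟩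
  have hu0 : ∀ z, dzbar (fun w : ℂ => u.1 w) z = 0 := fun z => by
    rw [← hfu, hfc, sub_self]
    rfl
  funext z
  have h1 := eq_of_dzbar_eq_zero u hu0 z (0 : ℂ)
  have h2 := hu 0
  rw [h0] at h2
  simp only [canonicalLift, map_zero, sub_zero, mul_zero, add_zero] at h2
  rw [hu, h1, ← h2, zero_add]

/-- The harmonic representative of the Kodaira-Spencer class of `v ∂_s` is
`-v / (s - s̄) dz̄ ⊗ ∂_z`. -/
theorem IsKodairaSpencer.eq_constFun {g : KahlerMetric s} {γ : ℝ} (hγ : 0 < γ)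
    (hg : ∀ x, g.coeff x = γ) {v : ℂ} {f : smoothFunctions s} (hf : IsHarmonicTangentForm g f)
    (h : IsKodairaSpencer s v (tangentFormClass f)) :
    f = constFun s (-(v / ((s : ℂ) - conj (s : ℂ)))) := by
  obtain ⟨b, f', hb, hf', hc⟩ := h
  obtain ⟨u, hu⟩ := hb.exists_eq_add
  refine hf.eq_constFun hγ hg ?_
  have h1 : f - f' ∈ exactTangentForms s := (Submodule.Quotient.eq _).1 hc.symm
  have h2 : f' - constFun s (-(v / ((s : ℂ) - conj (s : ℂ)))) ∈ exactTangentForms s :=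
    ⟨u, hf'.sub_constFun hu⟩
  have := add_mem h1 h2
  rwa [sub_add_sub_cancel] at this

theorem isKodairaSpencer_constFun (v : ℂ) : IsKodairaSpencer s v
    (tangentFormClass (constFun s (-(v / ((s : ℂ) - conj (s : ℂ)))))) :=
  ⟨_, _, isSmoothLift_canonicalLift v, isDbarOfLift_canonicalLift v, rfl⟩

theorem hasMFDerivAt_coe (α : ℍ) :
    HasMFDerivAt 𝓘(ℂ) 𝓘(ℂ) ((↑) : ℍ → ℂ) α (ContinuousLinearMap.id ℂ ℂ) := by
  refine ⟨UpperHalfPlane.continuous_coe.continuousAt, ?_⟩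
  refine ((hasFDerivAt_id (𝕜 := ℂ) (α : ℂ)).congr_of_eventuallyEq ?_).hasFDerivWithinAt
  filter_upwards [extChartAt_target_mem_nhds (I := 𝓘(ℂ)) α] with z hz
  exact (extChartAt 𝓘(ℂ) α).right_inv hz

/-- In the coordinates `(α, s)` the periods are `α`, so the horizontal vectors are those with
vanishing `∂_α`-component. -/
theorem isGaussManinHorizontal_iff {α s : ℍ} {β v : ℂ} :
    IsGaussManinHorizontal α s β v ↔ β = 0 := by
  have h : (fun κ : ℍ × ℍ => period κ.2 (kahlerClass κ.1 κ.2)) =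
      ((↑) : ℍ → ℂ) ∘ Prod.fst := by
    funext κ
    simp [kahlerClass, period_constClass]
  have h2 := (hasMFDerivAt_coe α).comp (α, s) (hasMFDerivAt_fst (I := 𝓘(ℂ)) (I' := 𝓘(ℂ)) (α, s))
  unfold IsGaussManinHorizontal
  rw [h, h2.mfderiv]
  rfl

/-! ### The differential of the quotient map -/

theorem isAddQuotientCoveringMap_q : IsAddQuotientCoveringMap q (ℤ × ℤ) :=
  isAddQuotientCoveringMap_quotientMk_of_properlyDiscontinuousVAdd (E := Cover) (G := ℤ × ℤ)

theorem isLocalHomeomorph_q : IsLocalHomeomorph q :=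
  isAddQuotientCoveringMap_q.isCoveringMap.isLocalHomeomorph

/-- The point of `ℂ × ℍ × ℍ` over `x` at which the preferred chart of the quotient at `x` inverts
the quotient map. -/
def basePoint (x : FibreProduct) : Cover :=
  (Quotient.mk_surjective (s := AddAction.orbitRel (ℤ × ℤ) Cover)).hasRightInverse.choose x

theorem q_basePoint (x : FibreProduct) : q (basePoint x) = x :=
  (Quotient.mk_surjective (s := AddAction.orbitRel (ℤ × ℤ) Cover)).hasRightInverse.choose_spec x

theorem q_vadd (γ : ℤ × ℤ) (p : Cover) : q (γ +ᵥ p) = q p :=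
  isAddQuotientCoveringMap_q.map_vadd γ

theorem exists_vadd_eq_basePoint (p : Cover) : ∃ γ : ℤ × ℤ, γ +ᵥ p = basePoint (q p) :=
  isAddQuotientCoveringMap_q.apply_eq_iff_mem_orbit.mp (q_basePoint (q p))

/-- The differential of `g_{n,m}`. -/
def vaddDeriv (γ : ℤ × ℤ) : (ℂ × ℂ × ℂ) →L[ℂ] (ℂ × ℂ × ℂ) :=
  (ContinuousLinearMap.fst ℂ ℂ (ℂ × ℂ) + (γ.2 : ℂ) •
    ((ContinuousLinearMap.snd ℂ ℂ ℂ).comp (ContinuousLinearMap.snd ℂ ℂ (ℂ × ℂ)))).prod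
    (ContinuousLinearMap.snd ℂ ℂ (ℂ × ℂ))

theorem vaddDeriv_apply (γ : ℤ × ℤ) (v : ℂ × ℂ × ℂ) :
    vaddDeriv γ v = (v.1 + γ.2 * v.2.2, v.2) := rfl

/-- Near `p` the quotient map, read in the preferred chart at `q p`, is the element `γ` of the group
which maps `p` to the base point of that chart. -/
theorem hasMFDerivAt_q {p : Cover} {γ : ℤ × ℤ} (h : γ +ᵥ p = basePoint (q p)) :
    HasMFDerivAt model model q p (vaddDeriv γ) := by
  have hc : Continuous q := isLocalHomeomorph_q.continuous
  refine ⟨hc.continuousAt, ?_⟩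
  have hd : HasFDerivAt (𝕜 := ℂ) (fun t : ℂ × ℂ × ℂ => (t.1 + γ.1 + γ.2 * t.2.2, t.2))
      (vaddDeriv γ) (extChartAt model p p) :=
    ((hasFDerivAt_fst.add_const _).add
      ((hasFDerivAt_snd.comp _ hasFDerivAt_snd).const_mul _)).prodMk hasFDerivAt_snd
  refine (hd.congr_of_eventuallyEq ?_).hasFDerivWithinAt
  have hA : γ +ᵥ p ∈ (isLocalHomeomorph_q.localInverseAt (basePoint (q p))).target := by
    rw [h]
    exact isLocalHomeomorph_q.self_mem_localInverseAt_target
  -- The local inverse of `q` undoes `q` only on its target, which `γ` reaches near `p`.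
  have h1 : ∀ᶠ t in 𝓝 (extChartAt model p p), γ +ᵥ ((extChartAt model p).symm t : Cover) ∈
      (isLocalHomeomorph_q.localInverseAt (basePoint (q p))).target := by
    have hcont : ContinuousAt (fun t => γ +ᵥ ((extChartAt model p).symm t : Cover))
        (extChartAt model p p) := (continuousAt_extChartAt_symm (I := model) p).const_vadd γ
    refine hcont.eventually
      ((isLocalHomeomorph_q.localInverseAt (basePoint (q p))).open_target.mem_nhds ?_)
    beta_reduce
    rwa [extChartAt_to_inv]
  filter_upwards [h1, extChartAt_target_mem_nhds (I := model) p] with t ht ht'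
  have h2 : isLocalHomeomorph_q.localInverseAt (basePoint (q p)) (q ((extChartAt model p).symm t)) =
      γ +ᵥ ((extChartAt model p).symm t : Cover) := by
    have h4 := OpenPartialHomeomorph.right_inv _ ht
    rwa [isLocalHomeomorph_q.localInverseAt_symm, q_vadd] at h4
  have h3 : extChartAt model p ((extChartAt model p).symm t) = t :=
    (extChartAt model p).right_inv ht'
  change extChartAt model p (isLocalHomeomorph_q.localInverseAt (basePoint (q p))
    (q ((extChartAt model p).symm t))) = _
  rw [h2]
  generalize (extChartAt model p).symm t = p' at h3
  rw [← h3]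
  rfl

theorem dq_eq {p : Cover} {γ : ℤ × ℤ} (h : γ +ᵥ p = basePoint (q p)) (v : ℂ × ℂ × ℂ) :
    dq p v = vaddDeriv γ v :=
  congrArg (fun L : (ℂ × ℂ × ℂ) →L[ℂ] (ℂ × ℂ × ℂ) => L v) (hasMFDerivAt_q h).mfderiv

theorem dq_add (p : Cover) (v w : ℂ × ℂ × ℂ) : dq p (v + w) = dq p v + dq p w :=
  (mfderiv model model q p).map_add v w

theorem dq_surjective (p : Cover) : Function.Surjective (dq p) := fun w => by
  obtain ⟨γ, h⟩ := exists_vadd_eq_basePoint p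
  let w' : ℂ × ℂ × ℂ := w
  refine ⟨(w'.1 - γ.2 * w'.2.2, w'.2), ?_⟩
  rw [dq_eq h, vaddDeriv_apply]
  exact Prod.ext (sub_add_cancel _ _) rfl

theorem extChartAt_fibreProduct_symm (x : FibreProduct) (t : ℂ × ℂ × ℂ) :
    (extChartAt model x).symm t = q ((extChartAt model (basePoint x)).symm t) :=
  congrFun (isLocalHomeomorph_q.localInverseAt_symm (basePoint x)) _

theorem extChartAt_fibreProduct_target_subset (x : FibreProduct) :
    (extChartAt model x).target ⊆ (extChartAt model (basePoint x)).target :=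
  fun _ ht => ⟨ht.1, ht.2.1⟩

theorem hasMFDerivAt_extChartAt_cover_symm {p : Cover} {t : ℂ × ℂ × ℂ}
    (ht : t ∈ (extChartAt model p).target) :
    HasMFDerivAt 𝓘(ℂ, ℂ × ℂ × ℂ) model (extChartAt model p).symm t
      (ContinuousLinearMap.id ℂ (ℂ × ℂ × ℂ)) := by
  refine ⟨continuousAt_extChartAt_symm'' ht, ?_⟩
  refine ((hasFDerivAt_id (𝕜 := ℂ) t).congr_of_eventuallyEq ?_).hasFDerivWithinAt
  filter_upwards [(isOpen_extChartAt_target (I := model) p).mem_nhds ht] with t' ht'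
  exact (extChartAt model p).right_inv ht'

/-- The coordinate frame of a holomorphic chart of the quotient is the image of the frame
`∂_z, ∂_α, ∂_s`. -/
theorem mfderiv_extChartAt_fibreProduct_symm {x : FibreProduct} {t : ℂ × ℂ × ℂ}
    (ht : t ∈ (extChartAt model x).target) (v : ℂ × ℂ × ℂ) :
    mfderiv 𝓘(ℂ, ℂ × ℂ × ℂ) model (extChartAt model x).symm t v =
      dq ((extChartAt model (basePoint x)).symm t) v := by
  obtain ⟨γ, h⟩ := exists_vadd_eq_basePoint ((extChartAt model (basePoint x)).symm t)
  have h1 : ((extChartAt model x).symm : ℂ × ℂ × ℂ → FibreProduct) =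
      q ∘ (extChartAt model (basePoint x)).symm := funext (extChartAt_fibreProduct_symm x)
  have h2 := (hasMFDerivAt_q h).comp t (hasMFDerivAt_extChartAt_cover_symm
    (extChartAt_fibreProduct_target_subset x ht))
  rw [dq_eq h]
  rw [← h1] at h2
  exact congrArg (fun L : (ℂ × ℂ × ℂ) →L[ℂ] (ℂ × ℂ × ℂ) => L v) h2.mfderiv

/-! ### The natural metric -/

/-- The hermitian form at `(z, α, s)` for which `∂_z`, `∂_α` and the horizontal vector
`∂_s + (z - z̄) / (s - s̄) ∂_z` are orthogonal, with squared norms `Im α / Im s`, `1 / (4 Im α)` and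
`Im α / (4 (Im s)²)`. -/
def naturalForm (p : Cover) (v w : ℂ × ℂ × ℂ) : ℂ :=
  (p.2.1.im / p.2.2.im : ℝ) *
      ((v.1 - (p.1.im / p.2.2.im : ℝ) * v.2.2) * conj (w.1 - (p.1.im / p.2.2.im : ℝ) * w.2.2)) +
    (1 / (4 * p.2.1.im) : ℝ) * (v.2.1 * conj w.2.1) +
    (p.2.1.im / (4 * p.2.2.im ^ 2) : ℝ) * (v.2.2 * conj w.2.2)

theorem naturalForm_vadd (γ : ℤ × ℤ) (p : Cover) (v w : ℂ × ℂ × ℂ) :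
    naturalForm (γ +ᵥ p) (vaddDeriv γ v) (vaddDeriv γ w) = naturalForm p v w := by
  have h : ((p.1 + γ.1 + γ.2 * (p.2.2 : ℂ)).im / p.2.2.im : ℝ) = p.1.im / p.2.2.im + γ.2 := by
    simp [add_div, p.2.2.im_pos.ne']
  simp only [naturalForm, vadd_def, vaddDeriv_apply, h]
  push_cast
  simp only [map_add, map_sub, map_mul, map_intCast]
  ring

theorem naturalForm_add_left (p : Cover) (u v w : ℂ × ℂ × ℂ) :
    naturalForm p (u + v) w = naturalForm p u w + naturalForm p v w := by
  simp only [naturalForm, Prod.fst_add, Prod.snd_add]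
  ring

theorem naturalForm_smul_left (p : Cover) (c : ℂ) (v w : ℂ × ℂ × ℂ) :
    naturalForm p (c • v) w = c * naturalForm p v w := by
  simp only [naturalForm, Prod.smul_fst, Prod.smul_snd, smul_eq_mul]
  ring

theorem naturalForm_conj_symm (p : Cover) (v w : ℂ × ℂ × ℂ) :
    conj (naturalForm p w v) = naturalForm p v w := by
  simp only [naturalForm, map_add, map_mul, map_sub, conj_conj, conj_ofReal]
  ring

theorem naturalForm_pos (p : Cover) {v : ℂ × ℂ × ℂ} (hv : v ≠ 0) :
    0 < (naturalForm p v v).re := by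
  have hα := p.2.1.im_pos
  have hs := p.2.2.im_pos
  simp only [naturalForm, mul_conj, ← ofReal_mul, ← ofReal_add, ofReal_re]
  set N := v.1 - (p.1.im / p.2.2.im : ℝ) * v.2.2 with hN
  have c1 : 0 < p.2.1.im / p.2.2.im := div_pos hα hs
  have c2 : 0 < 1 / (4 * p.2.1.im) := by positivity
  have c3 : 0 < p.2.1.im / (4 * p.2.2.im ^ 2) := by positivity
  have n1 := mul_nonneg c1.le (normSq_nonneg N)
  have n2 := mul_nonneg c2.le (normSq_nonneg v.2.1)
  have n3 := mul_nonneg c3.le (normSq_nonneg v.2.2)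
  by_contra hle
  have z1 : N = 0 := normSq_eq_zero.1 ((mul_eq_zero.1 (by linarith)).resolve_left c1.ne')
  have z2 : v.2.1 = 0 := normSq_eq_zero.1 ((mul_eq_zero.1 (by linarith)).resolve_left c2.ne')
  have z3 : v.2.2 = 0 := normSq_eq_zero.1 ((mul_eq_zero.1 (by linarith)).resolve_left c3.ne')
  refine hv (Prod.ext ?_ (Prod.ext z2 z3))
  simpa [hN, z3] using z1

theorem contDiffOn_naturalForm (v w : ℂ × ℂ × ℂ) (p : Cover) :
    ContDiffOn ℝ ∞ (fun t => naturalForm ((extChartAt model p).symm t) v w)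
      (extChartAt model p).target := by
  have hrw : ∀ t ∈ (extChartAt model p).target, ∃ p' : Cover,
      (extChartAt model p).symm t = p' ∧ t = (p'.1, (p'.2.1 : ℂ), (p'.2.2 : ℂ)) :=
    fun t ht => ⟨_, rfl, ((extChartAt model p).right_inv ht).symm⟩
  have e1 : ContDiff ℝ ∞ fun t : ℂ × ℂ × ℂ => t.1.im := imCLM.contDiff.comp contDiff_fst
  have e2 : ContDiff ℝ ∞ fun t : ℂ × ℂ × ℂ => t.2.1.im :=
    imCLM.contDiff.comp (contDiff_fst.comp contDiff_snd)
  have e3 : ContDiff ℝ ∞ fun t : ℂ × ℂ × ℂ => t.2.2.im :=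
    imCLM.contDiff.comp (contDiff_snd.comp contDiff_snd)
  have n2 : ∀ t ∈ (extChartAt model p).target, t.2.1.im ≠ 0 := fun t ht => by
    obtain ⟨p', -, rfl⟩ := hrw t ht
    exact p'.2.1.im_pos.ne'
  have n3 : ∀ t ∈ (extChartAt model p).target, t.2.2.im ≠ 0 := fun t ht => by
    obtain ⟨p', -, rfl⟩ := hrw t ht
    exact p'.2.2.im_pos.ne'
  have hr : ∀ {f : ℂ × ℂ × ℂ → ℝ}, ContDiffOn ℝ ∞ f (extChartAt model p).target →
      ContDiffOn ℝ ∞ (fun t => (f t : ℂ)) (extChartAt model p).target := fun h =>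
    ofRealCLM.contDiff.comp_contDiffOn h
  have hc : ∀ {f : ℂ × ℂ × ℂ → ℂ}, ContDiffOn ℝ ∞ f (extChartAt model p).target →
      ContDiffOn ℝ ∞ (fun t => conj (f t)) (extChartAt model p).target := fun h =>
    conjCLE.contDiff.comp_contDiffOn h
  have a1 := hr (e2.contDiffOn.div e3.contDiffOn n3)
  have a2 := hr (e1.contDiffOn.div e3.contDiffOn n3)
  have a3 := hr ((contDiff_const (c := (1 : ℝ))).contDiffOn.div
    ((contDiff_const (c := (4 : ℝ))).mul e2).contDiffOn
    fun t ht => mul_ne_zero four_ne_zero (n2 t ht))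
  have a4 := hr (e2.contDiffOn.div ((contDiff_const (c := (4 : ℝ))).mul (e3.pow 2)).contDiffOn
    fun t ht => mul_ne_zero four_ne_zero (pow_ne_zero 2 (n3 t ht)))
  have b : ∀ c d : ℂ, ContDiffOn ℝ ∞
      (fun t : ℂ × ℂ × ℂ => c - ((t.1.im / t.2.2.im : ℝ) : ℂ) * d)
      (extChartAt model p).target := fun c d => contDiffOn_const.sub (a2.mul contDiffOn_const)
  refine (((a1.mul ((b v.1 v.2.2).mul (hc (b w.1 w.2.2)))).add
    (a3.mul (contDiffOn_const (c := v.2.1 * conj w.2.1)))).add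
    (a4.mul (contDiffOn_const (c := v.2.2 * conj w.2.2)))).congr fun t ht => ?_
  obtain ⟨p', h, rfl⟩ := hrw t ht
  rw [h]
  rfl

/-- The form at the base point, read through the differential of `q`, is the form at any other
point of the fibre. -/
theorem naturalForm_dq (p : Cover) (v w : ℂ × ℂ × ℂ) :
    naturalForm (basePoint (q p)) (dq p v) (dq p w) = naturalForm p v w := by
  obtain ⟨γ, h⟩ := exists_vadd_eq_basePoint p
  rw [dq_eq h, dq_eq h, ← naturalForm_vadd γ p, h]

/-- The natural hermitian metric. The tangent space at `x` is read in the preferred chart at `x`,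
in which the differential of the quotient map at the base point over `x` is the identity. -/
def naturalMetric : HermitianMetric where
  inner x v w := naturalForm (basePoint x) v w
  add_left x u v w := naturalForm_add_left (basePoint x) u v w
  smul_left x c v w := naturalForm_smul_left (basePoint x) c v w
  conj_symm x v w := naturalForm_conj_symm (basePoint x) v w
  pos x v hv := naturalForm_pos (basePoint x) hv
  smooth x v w := by
    refine (contDiffOn_naturalForm v w (basePoint x)).mono
      (extChartAt_fibreProduct_target_subset x) |>.congr fun t ht => ?_
    rw [mfderiv_extChartAt_fibreProduct_symm ht v, mfderiv_extChartAt_fibreProduct_symm ht w,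
      extChartAt_fibreProduct_symm]
    exact naturalForm_dq _ v w

theorem naturalMetric_inner_dq (p : Cover) (v w : ℂ × ℂ × ℂ) :
    naturalMetric.inner (q p) (dq p v) (dq p w) = naturalForm p v w :=
  naturalForm_dq p v w

variable {z : ℂ} {α : ℍ} {g : KahlerMetric s}

theorem canonicalLift_eq (s : ℍ) (v z : ℂ) :
    canonicalLift s v z = (z.im / s.im : ℝ) * v := by
  have h := im_ne_zero s
  have h1 : (s : ℂ) - conj (s : ℂ) = 2 * I * s.im := by linear_combination -conj_sub_self_eq s
  rw [canonicalLift, h1, sub_conj, ofReal_div]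
  push_cast
  field_simp

/-- The horizontal lifts are the vectors `v (∂_s + (z - z̄) / (s - s̄) ∂_z)`. -/
theorem isHorizontalLift_iff (hg : g.RicciFlat) (hα : ImContains (kahlerClass α s) g) {v : ℂ}
    {h : TangentSpace model (q (z, α, s))} :
    IsHorizontalLift z α s g v h ↔ h = dq (z, α, s) (canonicalLift s v z, 0, v) := by
  have hγ := div_pos α.im_pos s.im_pos
  have hc := coeff_eq_of_imContains hg hα
  constructor
  · rintro ⟨b, β, hb, hβ, rfl⟩
    rw [hb.eq_canonicalLift hγ hc, isGaussManinHorizontal_iff.1 hβ]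
  · rintro rfl
    exact ⟨_, 0, isCanonicalLift_canonicalLift hγ hc v, isGaussManinHorizontal_iff.2 rfl, rfl⟩

/-- The `L²` product on `H^{1,1}(X_s, ℂ)`. -/
theorem innerForms_constFun (hc : ∀ x, g.coeff x = α.im / s.im) (β β' : ℂ) :
    innerForms g (constFun s (β / (s.im : ℂ) * (I / 2)))
      (constFun s (β' / (s.im : ℂ) * (I / 2))) =
      (1 / (4 * α.im) : ℝ) * (β * conj β') := by
  rw [innerForms_eq (div_pos α.im_pos s.im_pos) hc, integral_mulConj_const]
  change _ * (_ * integral s fun _ => β / (s.im : ℂ) * (I / 2)) = _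
  have h1 := im_ne_zero s
  have h2 := im_ne_zero α
  have h3 : conj (2 : ℂ) = 2 := conj_ofReal 2
  rw [integral_const, conj_sub_self_eq]
  simp only [map_mul, map_div₀, conj_ofReal, conj_I, h3]
  push_cast
  field_simp
  linear_combination (4 * β * conj β' * (I ^ 2 - 1)) * I_sq

/-- The `L²` product of Kodaira-Spencer classes on `H¹(X_s, T_{X_s})`. -/
theorem innerTangentForms_constFun (hc : ∀ x, g.coeff x = α.im / s.im) (v v' : ℂ) :
    innerTangentForms g (constFun s (-(v / ((s : ℂ) - conj (s : ℂ)))))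
      (constFun s (-(v' / ((s : ℂ) - conj (s : ℂ))))) =
      (α.im / (4 * s.im ^ 2) : ℝ) * (v * conj v') := by
  rw [innerTangentForms_eq (div_pos α.im_pos s.im_pos) hc, integral_mulConj_const]
  change _ * (_ * integral s fun _ => -(v / ((s : ℂ) - conj (s : ℂ)))) = _
  have h1 := im_ne_zero s
  have h3 : conj (2 : ℂ) = 2 := conj_ofReal 2
  have h4 : (s : ℂ) - conj (s : ℂ) = 2 * I * s.im := by linear_combination -conj_sub_self_eq s
  rw [integral_const, conj_sub_self_eq, h4]
  simp only [map_mul, map_div₀, map_neg, conj_ofReal, conj_I, h3]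
  push_cast
  field_simp
  ring

theorem isNaturalMetric_naturalMetric : IsNaturalMetric naturalMetric where
  relative_tangent z α s g hg hα u u' := by
    rw [naturalMetric_inner_dq, coeff_eq_of_imContains hg hα]
    simp [naturalForm]
    ring
  cohomology z α s g hg hα β β' f f' hf hβ hf' hβ' := by
    have hγ := div_pos α.im_pos s.im_pos
    have hc := coeff_eq_of_imContains hg hα
    rw [naturalMetric_inner_dq, hf.eq_constFun hγ hc hβ, hf'.eq_constFun hγ hc hβ',
      innerForms_constFun hc]
    simp [naturalForm]
  orthogonal z α s u β := by
    rw [naturalMetric_inner_dq]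
    simp [naturalForm]
  horizontal_orthogonal z α s g hg hα v h hh u β := by
    rw [(isHorizontalLift_iff hg hα).1 hh, naturalMetric_inner_dq]
    simp [naturalForm, canonicalLift_eq]
  horizontal z α s g hg hα v v' h h' hh hh' f f' hf hv hf' hv' := by
    have hγ := div_pos α.im_pos s.im_pos
    have hc := coeff_eq_of_imContains hg hα
    rw [(isHorizontalLift_iff hg hα).1 hh, (isHorizontalLift_iff hg hα).1 hh',
      naturalMetric_inner_dq, hv.eq_constFun hγ hc hf, hv'.eq_constFun hγ hc hf',
      innerTangentForms_constFun hc]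
    simp [naturalForm, canonicalLift_eq]

theorem HermitianMetric.add_right (Ω : HermitianMetric) (x : FibreProduct)
    (u v w : TangentSpace model x) : Ω.inner x u (v + w) = Ω.inner x u v + Ω.inner x u w := by
  rw [← Ω.conj_symm, Ω.add_left, map_add, Ω.conj_symm, Ω.conj_symm]

/-- The defining properties prescribe the metric on the frame formed by `∂_z`, `∂_α` and the
horizontal lift of `∂_s`. -/
theorem IsNaturalMetric.inner_dq {Ω : HermitianMetric} (hΩ : IsNaturalMetric Ω) (p : Cover)
    (v w : ℂ × ℂ × ℂ) : Ω.inner (q p) (dq p v) (dq p w) = naturalForm p v w := by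
  obtain ⟨z, α, s⟩ := p
  set g := flatMetric α s
  have hg : g.RicciFlat := flatMetric_ricciFlat α s
  have hα : ImContains (kahlerClass α s) g := flatMetric_imContains α s
  have hγ := div_pos α.im_pos s.im_pos
  have hc := coeff_eq_of_imContains hg hα
  -- The components of a tangent vector along `∂_z`, `∂_α` and the horizontal lift.
  have hdec : ∀ v : ℂ × ℂ × ℂ, dq (z, α, s) v =
      dq (z, α, s) (v.1 - (z.im / s.im : ℝ) * v.2.2, 0, 0) + dq (z, α, s) (0, v.2.1, 0) +
        dq (z, α, s) (canonicalLift s v.2.2 z, 0, v.2.2) := fun v => by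
    rw [← dq_add, ← dq_add, canonicalLift_eq]
    simp
  have o1 := fun u β => hΩ.orthogonal z α s u β
  have o2 : ∀ u β, Ω.inner (q (z, α, s)) (dq (z, α, s) (0, β, 0)) (dq (z, α, s) (u, 0, 0)) = 0 :=
    fun u β => by rw [← Ω.conj_symm, o1, map_zero]
  have o3 : ∀ v u β, Ω.inner (q (z, α, s)) (dq (z, α, s) (canonicalLift s v z, 0, v))
      (dq (z, α, s) (u, β, 0)) = 0 := fun v u β =>
    hΩ.horizontal_orthogonal z α s g hg hα v _ ((isHorizontalLift_iff hg hα).2 rfl) u β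
  have o4 : ∀ v u β, Ω.inner (q (z, α, s)) (dq (z, α, s) (u, β, 0))
      (dq (z, α, s) (canonicalLift s v z, 0, v)) = 0 :=
    fun v u β => by rw [← Ω.conj_symm, o3, map_zero]
  rw [hdec v, hdec w]
  simp only [Ω.add_left, Ω.add_right, o1, o2, o3, o4, add_zero, zero_add]
  rw [hΩ.relative_tangent z α s g hg hα, hΩ.cohomology z α s g hg hα v.2.1 w.2.1 _ _
      (isHarmonicForm_constFun hγ hc _) rfl (isHarmonicForm_constFun hγ hc _) rfl,
    hΩ.horizontal z α s g hg hα v.2.2 w.2.2 _ _ ((isHorizontalLift_iff hg hα).2 rfl)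
      ((isHorizontalLift_iff hg hα).2 rfl) _ _ (isHarmonicTangentForm_constFun hγ hc _)
      (isKodairaSpencer_constFun _) (isHarmonicTangentForm_constFun hγ hc _)
      (isKodairaSpencer_constFun _), innerForms_constFun hc, innerTangentForms_constFun hc, hc]
  simp only [naturalForm]
  ring

theorem HermitianMetric.ext_inner {Ω Ω' : HermitianMetric} (h : ∀ x v w, Ω.inner x v w =
    Ω'.inner x v w) : Ω = Ω' := by
  cases Ω
  cases Ω'
  congr
  funext x v w
  exact h x v w

theorem existsUnique_isNaturalMetric : ∃! Ω : HermitianMetric, IsNaturalMetric Ω := by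
  refine ⟨naturalMetric, isNaturalMetric_naturalMetric, fun Ω hΩ =>
    HermitianMetric.ext_inner fun x v w => ?_⟩
  obtain ⟨p, rfl⟩ := Quotient.mk_surjective x
  obtain ⟨v, rfl⟩ := dq_surjective p v
  obtain ⟨w, rfl⟩ := dq_surjective p w
  exact (hΩ.inner_dq p v w).trans (naturalMetric_inner_dq p v w).symm

end EllipticFamily

end

theorem mainTheorem2 :
    (∀ s : ℍ, Set.BijOn (fun α : ℍ => EllipticFamily.kahlerClass α s) Set.univ
      (EllipticFamily.complexifiedKahlerCone s)) ∧
    (∃! Ω : EllipticFamily.HermitianMetric, EllipticFamily.IsNaturalMetric Ω) ∧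
    ∀ Ω : EllipticFamily.HermitianMetric, EllipticFamily.IsNaturalMetric Ω →
      ∀ (z : ℂ) (α s : ℍ),
        let gXS : ℂ := ((α : ℂ) - conj (α : ℂ)) / ((s : ℂ) - conj (s : ℂ))
        let gL2 : ℂ := (I / 2) * (1 / ((α : ℂ) - conj (α : ℂ)))
        let gWP : ℂ := (I / 2) * (((α : ℂ) - conj (α : ℂ)) / ((s : ℂ) - conj (s : ℂ)) ^ 2)
        let a : ℂ := -((z - conj z) / ((s : ℂ) - conj (s : ℂ)))
        Ω.pullbackMatrix (z, α, s) =
          !![gXS,     0,   gXS * conj a;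
             0,       gL2, 0;
             a * gXS, 0,   gWP + a * gXS * conj a] := by
  refine ⟨EllipticFamily.bijOn_kahlerClass, EllipticFamily.existsUnique_isNaturalMetric,
    fun Ω hΩ z α s => ?_⟩
  intro gXS gL2 gWP a
  have hs := EllipticFamily.im_ne_zero s
  have hα := EllipticFamily.im_ne_zero α
  have es : (s : ℂ) - conj (s : ℂ) = 2 * I * s.im := by
    linear_combination -EllipticFamily.conj_sub_self_eq s
  have eα : (α : ℂ) - conj (α : ℂ) = 2 * I * α.im := by
    linear_combination -EllipticFamily.conj_sub_self_eq α
  have h1 : gXS = (α.im / s.im : ℝ) := by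
    simp only [gXS, es, eα]
    push_cast
    field_simp
  have h2 : gL2 = (1 / (4 * α.im) : ℝ) := by
    simp only [gL2, eα]
    push_cast
    field_simp
    norm_num
  have h3 : gWP = (α.im / (4 * s.im ^ 2) : ℝ) := by
    simp only [gWP, es, eα]
    push_cast
    field_simp
    norm_num
  have h4 : a = -((z.im / s.im : ℝ) : ℂ) := by
    simp only [a, es, sub_conj]
    push_cast
    field_simp
  clear_value gXS gL2 gWP a
  subst h1 h2 h3 h4
  ext i j
  simp only [EllipticFamily.HermitianMetric.pullbackMatrix, Matrix.of_apply, hΩ.inner_dq]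
  fin_cases i <;> fin_cases j <;> simp [EllipticFamily.naturalForm] <;> ring
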